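/- **Setting.** Let $(\mathcal S,\mathcal A,p,r_{\mathrm{rew}})$ be a Markov decision process with measurable state and action spaces, transition law $p(\cdot\mid s,a)$, reward $r_{\mathrm{rew}}$ and discount factor $\gamma\in[0,1)$. Let $\pi_\theta(a\mid s)>0$, $\theta\in\mathbb R^d$, be a family of policy densities with respect to a $\sigma$-finite measure on $\mathcal A$. Let $V^{\pi_\theta}(s)=\mathbb E[\sum_{t\ge1}\gamma^{t-1}r_{\mathrm{rew}}(s_t,a_t)\mid s_1=s;\pi_\theta]$, let $Q^{\pi_\theta}(s,a)$ be the same expectation given $s_1=s,a_1=a$, and let $g(s,a\mid\theta)=(Q^{\pi_\theta}(s,a)-V^{\pi_\theta}(s))\,\nabla_\theta\log\pi_\theta(a\mid s)$. Assume, with positive constants: (A.1) $|r_{\mathrm{rew}}|\le U_r$; $\theta\mapsto\pi_\theta(a\mid s)$ is differentiable; for all $s,a,\theta,\theta_1,\theta_2$: $\|\nabla\log\pi_{\theta_1}(a|s)-\nabla\log\pi_{\theta_2}(a|s)\|\le L_\Theta\|\theta_1-\theta_2\|$, $\|\nabla\log\pi_\theta(a|s)\|\le U_\Theta$, $\|\pi_{\theta_1}(\cdot|s)-\pi_{\theta_2}(\cdot|s)\|_{TV}\le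 U_\pi\|\theta_1-\theta_2\|$. (A.2) For each $\theta$ the state chain under $\pi_\theta$ has a stationary distribution $d^{\pi_\theta}$, and $\|\mathbb P(s_t\in\cdot\mid s_1=s)-d^{\pi_\theta}\|_{TV}\le\varphi(t):=\kappa_0\kappa^t$ for all $t\ge1$ and all $s,\theta$, where $\kappa_0>0$ and $\kappa\in(0,1)$ do not depend on $\theta$. Let $J:\mathbb R^d\to\mathbb R$ be the objective: $|J|\le U_J$ and its gradient is the policy gradient $\nabla J(\theta)=\mathbb E_{s\sim d^{\pi_\theta},\,a\sim\pi_\theta(\cdot|s)}[g(s,a\mid\theta)]$. **Algorithm (PG-VRER).** Let $n\ge1$, $c>1$, $U_f>0$, $r\in(0,1)$, $\eta_1>0$, and let $(B_k)$ be a nondecreasing sequence of positive integers (the buffer sizes). In iteration $k=1,2,\dots$ one draws $n$ further steps $(s^{(k,j)},a^{(k,j)})_{j\le n}$ of a single trajectory of the decision process, using the policy $\pi_{\theta_k}$ in iteration $k$ and continuing from the state reached in the previous iteration. Parameters and samples available beforehand carry indices $i\le0$ (there may be none). For $f_{i,k}(s,a)=\pi_{\theta_k}(a|s)/\pi_{\theta_i}(a|s)$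 put $$\widehat\nabla J^{R}_{i,k}=\frac1n\sum_{j=1}^n w\bigl(f_{i,k}(s^{(i,j)},a^{(i,j)})\bigr)\,g(s^{(i,j)},a^{(i,j)}\mid\theta_k),\qquad \widehat\nabla J^{PG}_k=\frac1n\sum_{j=1}^n g(s^{(k,j)},a^{(k,j)}\mid\theta_k),$$ where $w(f)=f$ for $R=LR$ and $w(f)=\min(f,U_f)$ for $R=CLR$. The reuse set $\mathcal U_k$ consists of those of the available indices $i\in(k-B_k,k]$ for which $\mathrm{Tr}\,\mathrm{Var}[\widehat\nabla J^R_{i,k}]\le c\,\mathrm{Tr}\,\mathrm{Var}[\widehat\nabla J^{PG}_k]$, and $$\theta_{k+1}=\theta_k+\eta_k\,\frac1{|\mathcal U_k|}\sum_{i\in\mathcal U_k}\widehat\nabla J^R_{i,k},\qquad \eta_k=\eta_1k^{-r}.$$ For $R=LR$ assume in addition the bounded likelihood ratio $\pi_{\theta_1}(a|s)/\pi_{\theta_2}(a|s)\le U_f$ for all $\theta_1,\theta_2,s,a$. **Claim.** $\nabla J$ is Lipschitz continuous, with a constant that depends only on the constants in the assumptions. Let $L>0$ be any Lipschitz constant of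 $\nabla J$, let $\eta_1\in(0,\frac1{4L}]$, and set $t^\star_K=\log_\kappa K^{-r/n}$, so that $\varphi(nt^\star_K)=\kappa_0K^{-r}$. There is a constant $C$, depending only on $n,\gamma,U_r,U_\Theta,L_\Theta,U_\pi,\kappa_0,\kappa,U_J,U_f,c,r,L,\eta_1$ (not on the decision process, the policies, the run or the buffer sizes), such that for both kinds of estimators and all $K\ge1$ $$\frac1K\sum_{k=1}^K\mathbb E\bigl[\|\nabla J(\theta_k)\|^2\bigr]\le C\left(\frac1{K^{1-r}}+\frac{(t^\star_K)^2}{K^r}+\frac{B_K+t^\star_K}{K^r}\right).$$ Consequently, if $B_K/K^r\to0$, then $\frac1K\sum_{k=1}^K\mathbb E[\|\nabla J(\theta_k)\|^2]\to0$. -/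

import Mathlib

open MeasureTheory ProbabilityTheory Filter Topology
open scoped ENNReal NNReal

universe u v w

namespace VRER

/-- The space `ℝᵈ` of policy parameters, with its Euclidean norm. -/
abbrev Param (d : ℕ) : Type := EuclideanSpace ℝ (Fin d)

/-- Total variation distance `sup_D |μ(D) - ν(D)|` over measurable `D` (for finite measures). -/
noncomputable def tvDist {α : Type*} [MeasurableSpace α] (μ ν : Measure α) : ℝ :=
  ⨆ D : {D : Set α // MeasurableSet D}, |μ.real D.1 - ν.real D.1|

/-- Total variance `Tr (Var Z)` of a random vector: the sum of the variances of its coordinates. -/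
noncomputable def totalVariance {Ω : Type*} [MeasurableSpace Ω] {d : ℕ}
    (Z : Ω → Param d) (μ : Measure Ω) : ℝ :=
  ∑ l, Var[fun ω => Z ω l; μ]

/-- A Markov decision process (transition law `trans`, reward `reward`) together with a family of
stochastic policies, parametrised by `θ ∈ ℝᵈ` and given by strictly positive probability densities
`dens θ s a = π_θ(a|s)` with respect to a reference measure on the actions. -/
structure MDP (d : ℕ) (S A : Type*) [MeasurableSpace S] [MeasurableSpace A] where
  trans : Kernel (S × A) S
  isMarkov : IsMarkovKernel trans
  reward : S × A → ℝ
  measurable_reward : Measurable reward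
  actionRef : Measure A
  sigmaFinite : SigmaFinite actionRef
  dens : Param d → S → A → ℝ
  measurable_dens : Measurable fun z : Param d × S × A => dens z.1 z.2.1 z.2.2
  dens_pos : ∀ θ s a, 0 < dens θ s a
  lintegral_dens : ∀ θ s, ∫⁻ a, ENNReal.ofReal (dens θ s a) ∂actionRef = 1

namespace MDP

variable {d : ℕ} {S A : Type*} [MeasurableSpace S] [MeasurableSpace A]

attribute [instance] isMarkov sigmaFinite

/-- The policy `π_θ(·|s)` as a kernel from states to actions. -/
noncomputable def policy (M : MDP d S A) (θ : Param d) : Kernel S A :=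
  Kernel.withDensity (Kernel.const S M.actionRef) fun s a => ((M.dens θ s a).toNNReal : ℝ≥0∞)

theorem policy_apply (M : MDP d S A) (θ : Param d) (s : S) :
    M.policy θ s = M.actionRef.withDensity fun a => ENNReal.ofReal (M.dens θ s a) := by
  unfold policy
  rw [Kernel.withDensity_apply]
  · rfl
  · have h : Measurable fun z : S × A => M.dens θ z.1 z.2 :=
      M.measurable_dens.comp (measurable_const.prodMk measurable_id)
    exact h.real_toNNReal.coe_nnreal_ennreal

instance (M : MDP d S A) (θ : Param d) : IsMarkovKernel (M.policy θ) :=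
  ⟨fun s => ⟨by
    rw [policy_apply, withDensity_apply _ MeasurableSet.univ, Measure.restrict_univ,
      M.lintegral_dens]⟩⟩

/-- From a state `s`, the law of `(s, a)` with `a ∼ π_θ(·|s)`. -/
noncomputable def act (M : MDP d S A) (θ : Param d) : Kernel S (S × A) :=
  Kernel.id ×ₖ M.policy θ

/-- One step of the state chain under the fixed policy `π_θ`. -/
noncomputable def stateKernel (M : MDP d S A) (θ : Param d) : Kernel S S :=
  M.trans ∘ₖ M.act θ

/-- One step of the state-action chain under the fixed policy `π_θ`. -/
noncomputable def pairKernel (M : MDP d S A) (θ : Param d) : Kernel (S × A) (S × A) :=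
  M.act θ ∘ₖ M.trans

/-- Action-value function: `∑ₜ γᵗ E[r(s_{t+1}, a_{t+1}) | (s₁, a₁) = x]` under `π_θ`. -/
noncomputable def Q (M : MDP d S A) (γ : ℝ) (θ : Param d) (x : S × A) : ℝ :=
  ∑' t : ℕ, γ ^ t * ∫ y, M.reward y ∂((M.pairKernel θ ^ t) x)

/-- State-value function: `∑ₜ γᵗ E[r(s_{t+1}, a_{t+1}) | s₁ = s]` under `π_θ`. -/
noncomputable def V (M : MDP d S A) (γ : ℝ) (θ : Param d) (s : S) : ℝ :=
  ∑' t : ℕ, γ ^ t * ∫ y, M.reward y ∂(((M.pairKernel θ ^ t) ∘ₖ M.act θ) s)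

/-- The score `∇_θ log π_θ(a|s)` at `x = (s, a)`. -/
noncomputable def score (M : MDP d S A) (θ : Param d) (x : S × A) : Param d :=
  gradient (fun θ' => Real.log (M.dens θ' x.1 x.2)) θ

/-- Scenario-based gradient `g(s,a|θ) = A^{π_θ}(s,a) ∇ log π_θ(a|s)`, with `A = Q - V`. -/
noncomputable def scenarioGrad (M : MDP d S A) (γ : ℝ) (θ : Param d) (x : S × A) : Param d :=
  (M.Q γ θ x - M.V γ θ x.1) • M.score θ x

/-- The policy gradient `E_{s ∼ dstat θ, a ∼ π_θ(·|s)} [g(s,a|θ)]`. -/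
noncomputable def policyGrad (M : MDP d S A) (γ : ℝ) (dstat : Param d → Measure S)
    (θ : Param d) : Param d :=
  ∫ x, M.scenarioGrad γ θ x ∂(dstat θ ⊗ₘ M.policy θ)

/-- Regularity of rewards and policies: bounded rewards, differentiable policies, Lipschitz and
bounded score, Lipschitz policies in total variation. -/
structure Regular (M : MDP d S A) (Ur UΘ LΘ Uπ : ℝ) : Prop where
  reward_le : ∀ x, |M.reward x| ≤ Ur
  differentiable : ∀ s a, Differentiable ℝ fun θ => M.dens θ s a
  score_lipschitz : ∀ x θ₁ θ₂, ‖M.score θ₁ x - M.score θ₂ x‖ ≤ LΘ * ‖θ₁ - θ₂‖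
  score_le : ∀ x θ, ‖M.score θ x‖ ≤ UΘ
  policy_lipschitz : ∀ s θ₁ θ₂, tvDist (M.policy θ₁ s) (M.policy θ₂ s) ≤ Uπ * ‖θ₁ - θ₂‖

/-- `dstat θ` is a stationary distribution of the state chain under `π_θ`, and the law of `s_t`
given `s₁ = s` is within `κ₀ κᵗ` of it in total variation, for all `t ≥ 1` and all `s`. -/
structure UniformlyErgodic (M : MDP d S A) (dstat : Param d → Measure S) (κ₀ κ : ℝ) : Prop where
  isProbability : ∀ θ, IsProbabilityMeasure (dstat θ)
  invariant : ∀ θ, (M.stateKernel θ).Invariant (dstat θ)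
  mixing : ∀ θ s, ∀ t : ℕ, 1 ≤ t →
    tvDist ((M.stateKernel θ ^ (t - 1)) s) (dstat θ) ≤ κ₀ * κ ^ t

/-- `J` is a bounded objective whose gradient is the policy gradient. -/
structure IsObjective (M : MDP d S A) (γ : ℝ) (dstat : Param d → Measure S) (UJ : ℝ)
    (J : Param d → ℝ) : Prop where
  hasGradientAt : ∀ θ, HasGradientAt J (M.policyGrad γ dstat θ) θ
  abs_le : ∀ θ, |J θ| ≤ UJ

end MDP

/-- The two kinds of estimators: likelihood ratio and clipped likelihood ratio. -/
inductive EstimatorKind where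
  | LR
  | CLR

/-- The weight that a sample with likelihood ratio `f` receives. -/
noncomputable def EstimatorKind.weight (R : EstimatorKind) (Uf f : ℝ) : ℝ :=
  match R with
  | .LR => f
  | .CLR => min f Uf

/-- The random quantities of a run: `θ k` is the policy parameter of iteration `k` and `x k j`,
for `j < n`, is the state-action pair number `j + 1` collected in iteration `k`. Iterations of the
run are numbered `1, 2, …`; indices `≤ 0` serve for parameters and samples which are available
before the run starts. -/
structure Run (d : ℕ) (S A Ω : Type*) where
  θ : ℤ → Ω → Param d
  x : ℤ → ℕ → Ω → S × A

section Estimators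

variable {d : ℕ} {S A Ω : Type*} [MeasurableSpace S] [MeasurableSpace A]

/-- Individual estimator at the target `θ_k` from the `n` samples collected under `θ_i`. -/
noncomputable def indivEstimator (M : MDP d S A) (γ : ℝ) (n : ℕ) (R : EstimatorKind) (Uf : ℝ)
    (X : Run d S A Ω) (i k : ℤ) (ω : Ω) : Param d :=
  (n : ℝ)⁻¹ • ∑ j ∈ Finset.range n,
    R.weight Uf (M.dens (X.θ k ω) (X.x i j ω).1 (X.x i j ω).2 /
        M.dens (X.θ i ω) (X.x i j ω).1 (X.x i j ω).2) •
      M.scenarioGrad γ (X.θ k ω) (X.x i j ω)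

/-- Classical policy gradient estimator of iteration `k`. -/
noncomputable def pgEstimator (M : MDP d S A) (γ : ℝ) (n : ℕ) (X : Run d S A Ω) (k : ℤ)
    (ω : Ω) : Param d :=
  (n : ℝ)⁻¹ • ∑ j ∈ Finset.range n, M.scenarioGrad γ (X.θ k ω) (X.x k j ω)

/-- Indices of the parameters in the replay buffer at iteration `k`: the `B k` most recent ones
among those of the run and the initial stock `F₀`. -/
noncomputable def buffer (B : ℕ → ℕ) (F₀ : Finset ℤ) (k : ℕ) : Finset ℤ :=
  (Finset.Ioc ((k : ℤ) - B k) k).filter fun i => 1 ≤ i ∨ i ∈ F₀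

open Classical in
/-- The reuse set of iteration `k`: the buffered indices whose individual estimator has total
variance at most `c` times that of the classical policy gradient estimator. -/
noncomputable def reuseSet [MeasurableSpace Ω] (M : MDP d S A) (γ : ℝ) (n : ℕ)
    (R : EstimatorKind) (Uf c : ℝ) (B : ℕ → ℕ) (F₀ : Finset ℤ) (μ : Measure Ω)
    (X : Run d S A Ω) (k : ℕ) : Finset ℤ :=
  (buffer B F₀ k).filter fun i =>
    totalVariance (indivEstimator M γ n R Uf X i k) μ ≤
      c * totalVariance (pgEstimator M γ n X k) μ

/-- The average of the individual estimators over the reuse set. -/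
noncomputable def avgEstimator [MeasurableSpace Ω] (M : MDP d S A) (γ : ℝ) (n : ℕ)
    (R : EstimatorKind) (Uf c : ℝ) (B : ℕ → ℕ) (F₀ : Finset ℤ) (μ : Measure Ω)
    (X : Run d S A Ω) (k : ℕ) (ω : Ω) : Param d :=
  ((reuseSet M γ n R Uf c B F₀ μ X k).card : ℝ)⁻¹ •
    ∑ i ∈ reuseSet M γ n R Uf c B F₀ μ X k, indivEstimator M γ n R Uf X i k ω

/-- The iteration to which the time step `l = 0, 1, 2, …` of the run belongs. -/
def stepIter (n l : ℕ) : ℤ := ((l / n : ℕ) : ℤ) + 1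

/-- The state-action pair at the time step `l = 0, 1, 2, …` of the run. -/
def Run.step (X : Run d S A Ω) (n l : ℕ) : Ω → S × A := X.x (stepIter n l) (l % n)

/-- `X` is a run of the policy gradient method with variance reduction experience replay, with
learning rates `η₁ k^{-r}`. The samples form one trajectory of the decision process, in which the
actions of iteration `k` are drawn from `π_{θ_k}`; `ℱ l` is the information available when the
action of time step `l` is about to be drawn. -/
structure IsPGVRER [mΩ : MeasurableSpace Ω] (M : MDP d S A) (γ : ℝ) (n : ℕ) (R : EstimatorKind)
    (Uf c η₁ r : ℝ) (B : ℕ → ℕ) (F₀ : Finset ℤ) (μ : Measure Ω) (ℱ : Filtration ℕ mΩ)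
    (X : Run d S A Ω) : Prop where
  stock_nonpos : ∀ i ∈ F₀, i ≤ 0
  stock_param : ∀ i ∈ F₀, Measurable[ℱ 0] (X.θ i)
  stock_sample : ∀ i ∈ F₀, ∀ j, Measurable[ℱ 0] (X.x i j)
  param_adapted : ∀ k : ℕ, Measurable[ℱ (n * k)] (X.θ (k + 1))
  state_adapted : ∀ l, Measurable[ℱ l] fun ω => (X.step n l ω).1
  action_adapted : ∀ l, Measurable[ℱ (l + 1)] fun ω => (X.step n l ω).2
  /-- Given the past, the action is drawn from the current policy and the next state from the
  transition law. -/
  law : ∀ l, ∀ D : Set (A × S), MeasurableSet D →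
    μ[Set.indicator {ω | ((X.step n l ω).2, (X.step n (l + 1) ω).1) ∈ D}
        (fun _ => (1 : ℝ)) | ℱ l] =ᵐ[μ]
      fun ω => ((M.policy (X.θ (stepIter n l) ω) ⊗ₖ M.trans) (X.step n l ω).1).real D
  update : ∀ k : ℕ, 1 ≤ k → ∀ ω, X.θ (k + 1) ω =
    X.θ k ω + (η₁ * (k : ℝ) ^ (-r)) • avgEstimator M γ n R Uf c B F₀ μ X k ω

/-- The average over the first `K` iterations of the expected squared gradient norm. -/
noncomputable def avgSqGrad [MeasurableSpace Ω] (J : Param d → ℝ) (μ : Measure Ω)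
    (X : Run d S A Ω) (K : ℕ) : ℝ :=
  (1 / (K : ℝ)) * ∑ k ∈ Finset.Icc 1 K, ∫ ω, ‖gradient J (X.θ (k : ℤ) ω)‖ ^ 2 ∂μ

end Estimators

/-- The lag `t*_K = log_κ (K^{-r/n})`. -/
noncomputable def mixingLag (κ r : ℝ) (n K : ℕ) : ℝ :=
  Real.logb κ ((K : ℝ) ^ (-(r / n)))

end VRER

/-
Since the scores are bounded and Lipschitz and the policies are Lipschitz in total variation, the
value functions, the scenario-based gradients and (by geometric ergodicity) the stationary laws are
Lipschitz in the parameter, and hence so is the policy gradient.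

One iteration moves the parameter by at most a multiple of the learning rate. So the states visited
`m` iterations after a reference iteration are close in law to those of the chain with the reference
parameter frozen, which is nearly stationary; and since the log-densities are Lipschitz, the weights
of the reused samples are close to `min 1 Uf`, whichever samples the reuse rule selects. The mean of
the inner product of `∇J(θ_k)` with the update direction is thus at least `min 1 Uf * ‖∇J(θ_k)‖²` up
to a bias proportional to the learning rate. Inserting this in the ascent inequality for `J`,
dividing by the learning rate and summing by parts bounds the average of `‖∇J(θ_k)‖²`.
-/

namespace VRER

section BoundedFunctions

variable {α β δ : Type*} [MeasurableSpace α] [MeasurableSpace β] [MeasurableSpace δ]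

theorem integrable_of_measurable_of_abs_le {μ : Measure α} [IsFiniteMeasure μ] {f : α → ℝ} {b : ℝ}
    (hf : Measurable f) (hb : ∀ x, |f x| ≤ b) : Integrable f μ :=
  Integrable.of_bound hf.aestronglyMeasurable b (.of_forall hb)

theorem abs_integral_le_of_abs_le {μ : Measure α} [IsProbabilityMeasure μ] {f : α → ℝ} {b : ℝ}
    (hb : ∀ x, |f x| ≤ b) : |∫ x, f x ∂μ| ≤ b := by
  simpa using norm_integral_le_of_norm_le_const (μ := μ) (f := f) (C := b) (.of_forall hb)

theorem measurable_integral_kernel (κ : Kernel α β) {f : β → ℝ} (hf : Measurable f) :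
    Measurable fun x => ∫ y, f y ∂κ x :=
  (hf.stronglyMeasurable.integral_kernel (κ := κ)).measurable

theorem measurable_integral_kernel_prod (κ : Kernel α β) [IsSFiniteKernel κ] {f : α × β → ℝ}
    (hf : Measurable f) : Measurable fun x => ∫ y, f (x, y) ∂κ x :=
  (hf.stronglyMeasurable.integral_kernel_prod_right' (κ := κ)).measurable

theorem integral_kernel_comp (κ : Kernel α β) (η : Kernel β δ) [IsFiniteKernel κ]
    [IsFiniteKernel η] {f : δ → ℝ} {b : ℝ} (hf : Measurable f) (hb : ∀ x, |f x| ≤ b) (x : α) :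
    ∫ z, f z ∂((η ∘ₖ κ) x) = ∫ y, ∫ z, f z ∂η y ∂κ x :=
  Kernel.integral_comp (integrable_of_measurable_of_abs_le hf hb)

theorem integral_of_invariant {μ : Measure α} [IsFiniteMeasure μ] {κ : Kernel α α}
    [IsFiniteKernel κ] (hμ : κ.Invariant μ) {f : α → ℝ} {b : ℝ} (hf : Measurable f)
    (hb : ∀ x, |f x| ≤ b) : ∫ x, ∫ y, f y ∂κ x ∂μ = ∫ x, f x ∂μ := by
  have h := integral_kernel_comp (Kernel.const Unit μ) κ hf hb ()
  rw [Kernel.comp_apply, Kernel.const_apply, hμ.def] at h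
  exact h.symm

instance isMarkovKernel_pow (κ : Kernel α α) [IsMarkovKernel κ] (t : ℕ) :
    IsMarkovKernel (κ ^ t) := by
  induction t with
  | zero => rw [pow_zero]; exact inferInstanceAs (IsMarkovKernel Kernel.id)
  | succ t ih => rw [Kernel.pow_add, pow_one]; infer_instance

theorem integral_kernel_pow_succ (κ : Kernel α α) [IsMarkovKernel κ] {f : α → ℝ} {b : ℝ}
    (hf : Measurable f) (hb : ∀ x, |f x| ≤ b) (t : ℕ) (x : α) :
    ∫ z, f z ∂((κ ^ (t + 1)) x) = ∫ y, ∫ z, f z ∂(κ ^ t) y ∂κ x := by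
  rw [Kernel.pow_add, pow_one, integral_kernel_comp _ _ hf hb]

theorem integral_kernel_pow_zero (κ : Kernel α α) {f : α → ℝ} (hf : Measurable f) (x : α) :
    ∫ z, f z ∂((κ ^ 0) x) = f x := by
  rw [pow_zero]
  change ∫ z, f z ∂(Kernel.id x) = f x
  rw [Kernel.id_apply, integral_dirac' _ _ hf.stronglyMeasurable]

end BoundedFunctions

section IntegralDist

variable {α β δ : Type*} [MeasurableSpace α] [MeasurableSpace β] [MeasurableSpace δ]

/-- The measures `μ` and `ν` differ by at most `ε` when tested against functions with values in
`[-1, 1]`. Stated for all bounds `b` at once, so that no function has to be rescaled; it is the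
form in which total variation estimates are propagated along a chain. -/
def IntegralDistLE (μ ν : Measure α) (ε : ℝ) : Prop :=
  ∀ (f : α → ℝ) (b : ℝ), Measurable f → (∀ x, |f x| ≤ b) →
    |∫ x, f x ∂μ - ∫ x, f x ∂ν| ≤ b * ε

/-- The kernels `κ` and `η` are within `ε` of each other from every starting point, in the sense of
`IntegralDistLE`. -/
def KernelDistLE (κ η : Kernel α β) (ε : ℝ) : Prop :=
  ∀ x, IntegralDistLE (κ x) (η x) ε

theorem IntegralDistLE.refl (μ : Measure α) : IntegralDistLE μ μ 0 := by
  intro f b _ _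
  simp

theorem IntegralDistLE.nonneg {μ ν : Measure α} {ε : ℝ} (h : IntegralDistLE μ ν ε) : 0 ≤ ε := by
  simpa using h (fun _ => 0) 1 measurable_const fun _ => by simp

theorem IntegralDistLE.norm_integral_sub_le {E : Type*} [NormedAddCommGroup E] [NormedSpace ℝ E]
    [CompleteSpace E] {μ ν : Measure α} [IsProbabilityMeasure μ] [IsFiniteMeasure ν] {ε : ℝ}
    (h : IntegralDistLE μ ν ε) {G : α → E} {b : ℝ} (hG : StronglyMeasurable G)
    (hb : ∀ x, ‖G x‖ ≤ b) : ‖∫ x, G x ∂μ - ∫ x, G x ∂ν‖ ≤ b * ε := by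
  obtain ⟨x₀⟩ := nonempty_of_isProbabilityMeasure μ
  have hb₀ : 0 ≤ b := (norm_nonneg _).trans (hb x₀)
  have hint : ∀ ρ : Measure α, IsFiniteMeasure ρ → Integrable G ρ := fun ρ _ =>
    Integrable.of_bound hG.aestronglyMeasurable b (.of_forall hb)
  refine NormedSpace.norm_le_dual_bound ℝ _ (mul_nonneg hb₀ h.nonneg) fun φ => ?_
  rw [map_sub, ← φ.integral_comp_comm (hint μ inferInstance),
    ← φ.integral_comp_comm (hint ν inferInstance)]
  refine (h (fun x => φ (G x)) (‖φ‖ * b) (φ.continuous.comp_stronglyMeasurable hG).measurable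
    fun x => φ.le_opNorm_of_le (hb x)).trans_eq (by ring)

theorem IntegralDistLE.compProd {μ₁ μ₂ : Measure α} [IsProbabilityMeasure μ₁]
    [IsProbabilityMeasure μ₂] {κ₁ κ₂ : Kernel α β} [IsMarkovKernel κ₁] [IsMarkovKernel κ₂]
    {ε ε' : ℝ} (hμ : IntegralDistLE μ₁ μ₂ ε) (hκ : KernelDistLE κ₁ κ₂ ε') :
    IntegralDistLE (μ₁ ⊗ₘ κ₁) (μ₂ ⊗ₘ κ₂) (ε + ε') := by
  intro f b hf hb
  have hm : ∀ (κ : Kernel α β) [IsMarkovKernel κ], Measurable fun x => ∫ y, f (x, y) ∂κ x :=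
    fun κ _ => measurable_integral_kernel_prod κ hf
  have hbd : ∀ (κ : Kernel α β) [IsMarkovKernel κ] (x : α), |∫ y, f (x, y) ∂κ x| ≤ b :=
    fun κ _ x => abs_integral_le_of_abs_le fun y => hb _
  have hfst : |∫ x, ∫ y, f (x, y) ∂κ₁ x ∂μ₁ - ∫ x, ∫ y, f (x, y) ∂κ₂ x ∂μ₁| ≤ b * ε' := by
    rw [← integral_sub (integrable_of_measurable_of_abs_le (hm κ₁) (hbd κ₁))
      (integrable_of_measurable_of_abs_le (hm κ₂) (hbd κ₂))]
    exact abs_integral_le_of_abs_le fun x =>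
      hκ x _ b (hf.comp measurable_prodMk_left) fun y => hb _
  rw [Measure.integral_compProd (integrable_of_measurable_of_abs_le hf hb),
    Measure.integral_compProd (integrable_of_measurable_of_abs_le hf hb)]
  calc _ ≤ _ := abs_sub_le _ (∫ x, ∫ y, f (x, y) ∂κ₂ x ∂μ₁) _
    _ ≤ b * ε' + b * ε := add_le_add hfst (hμ _ b (hm κ₂) (hbd κ₂))
    _ = b * (ε + ε') := by ring

theorem KernelDistLE.refl (κ : Kernel α β) : KernelDistLE κ κ 0 :=
  fun x => IntegralDistLE.refl (κ x)

theorem KernelDistLE.comp {κ₁ κ₂ : Kernel α β} {η₁ η₂ : Kernel β δ} [IsMarkovKernel κ₁]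
    [IsMarkovKernel κ₂] [IsMarkovKernel η₁] [IsMarkovKernel η₂] {ε ε' : ℝ}
    (hη : KernelDistLE η₁ η₂ ε') (hκ : KernelDistLE κ₁ κ₂ ε) :
    KernelDistLE (η₁ ∘ₖ κ₁) (η₂ ∘ₖ κ₂) (ε + ε') := by
  intro x f b hf hb
  have h := (hκ x).compProd hη (fun z => f z.2) b (hf.comp measurable_snd) fun z => hb z.2
  have hsnd : ∀ {κ : Kernel α β} {η : Kernel β δ} [IsMarkovKernel κ] [IsMarkovKernel η],
      ∫ z, f z.2 ∂(κ x ⊗ₘ η) = ∫ z, f z ∂((η ∘ₖ κ) x) := fun {κ η} _ _ => by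
    have hint : Integrable (fun z : β × δ => f z.2) (κ x ⊗ₘ η) :=
      integrable_of_measurable_of_abs_le (hf.comp measurable_snd) fun z => hb z.2
    rw [integral_kernel_comp _ _ hf hb, Measure.integral_compProd hint]
  rwa [hsnd, hsnd] at h

theorem KernelDistLE.pow {κ η : Kernel α α} [IsMarkovKernel κ] [IsMarkovKernel η] {ε : ℝ}
    (h : KernelDistLE κ η ε) (t : ℕ) : KernelDistLE (κ ^ t) (η ^ t) (t * ε) := by
  induction t with
  | zero =>
    rw [pow_zero, pow_zero, Nat.cast_zero, zero_mul]
    exact KernelDistLE.refl 1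
  | succ t ih =>
    rw [Kernel.pow_add, Kernel.pow_add, pow_one, pow_one]
    convert ih.comp h using 1
    push_cast
    ring

end IntegralDist

section TotalVariation

variable {α : Type*} [MeasurableSpace α]

theorem abs_measureReal_sub_le_tvDist {μ ν : Measure α} [IsFiniteMeasure μ] [IsFiniteMeasure ν]
    {D : Set α} (hD : MeasurableSet D) : |μ.real D - ν.real D| ≤ tvDist μ ν := by
  refine le_ciSup (f := fun D : {D : Set α // MeasurableSet D} => |μ.real D.1 - ν.real D.1|)
    ⟨μ.real Set.univ + ν.real Set.univ, ?_⟩ ⟨D, hD⟩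
  rintro _ ⟨E, rfl⟩
  refine (abs_sub _ _).trans (add_le_add ?_ ?_) <;>
  · rw [abs_of_nonneg measureReal_nonneg]
    exact measureReal_mono (Set.subset_univ _)

theorem integrableOn_measureReal_superlevel (μ : Measure α) [IsFiniteMeasure μ] (f : α → ℝ)
    {s : Set ℝ} (hs : volume s ≠ ∞) : IntegrableOn (fun t => μ.real {x | t ≤ f x}) s := by
  have hanti : Antitone fun t => μ.real {x | t ≤ f x} := fun _ _ hst =>
    measureReal_mono fun _ hx => hst.trans hx
  refine Measure.integrableOn_of_bounded (M := μ.real Set.univ) hs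
    hanti.measurable.aestronglyMeasurable (.of_forall fun t => ?_)
  rw [Real.norm_of_nonneg measureReal_nonneg]
  exact measureReal_mono (Set.subset_univ _)

theorem integral_eq_setIntegral_superlevel_sub (μ : Measure α) [IsProbabilityMeasure μ] {f : α → ℝ}
    {b : ℝ} (hf : Measurable f) (hb : ∀ x, |f x| ≤ b) :
    ∫ x, f x ∂μ = (∫ t in Set.Ioc 0 (2 * b), μ.real {x | t ≤ f x + b}) - b := by
  have hint : Integrable f μ := integrable_of_measurable_of_abs_le hf hb
  have hpos : ∀ x, 0 ≤ f x + b := fun x => by linarith [(abs_le.1 (hb x)).1]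
  have hle : ∀ x, f x + b ≤ 2 * b := fun x => by linarith [(abs_le.1 (hb x)).2]
  have h := (hint.add (integrable_const b)).integral_eq_integral_Ioc_meas_le (M := 2 * b)
    (.of_forall hpos) (.of_forall hle)
  simp only [Pi.add_apply] at h
  rw [← h, integral_add hint (integrable_const b)]
  simp

theorem integralDistLE_of_tvDist_le {μ ν : Measure α} [IsProbabilityMeasure μ]
    [IsProbabilityMeasure ν] {ε : ℝ} (h : tvDist μ ν ≤ ε) : IntegralDistLE μ ν (2 * ε) := by
  intro f b hf hb
  obtain ⟨x₀⟩ := nonempty_of_isProbabilityMeasure μ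
  have hb₀ : 0 ≤ b := (abs_nonneg _).trans (hb x₀)
  have hfin : volume (Set.Ioc 0 (2 * b)) ≠ ∞ := measure_Ioc_lt_top.ne
  rw [integral_eq_setIntegral_superlevel_sub μ hf hb,
    integral_eq_setIntegral_superlevel_sub ν hf hb, sub_sub_sub_cancel_right,
    ← integral_sub (integrableOn_measureReal_superlevel μ _ hfin)
      (integrableOn_measureReal_superlevel ν _ hfin), ← Real.norm_eq_abs]
  calc ‖∫ t in Set.Ioc 0 (2 * b), (μ.real {x | t ≤ f x + b} - ν.real {x | t ≤ f x + b})‖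
      ≤ ε * volume.real (Set.Ioc 0 (2 * b)) :=
        norm_setIntegral_le_of_norm_le_const hfin.lt_top fun t _ =>
          (abs_measureReal_sub_le_tvDist
            (measurableSet_le measurable_const (hf.add_const b))).trans h
    _ = b * (2 * ε) := by
        rw [Real.volume_real_Ioc_of_le (by positivity)]
        ring

end TotalVariation

section StationaryPerturbation

variable {α : Type*} [MeasurableSpace α]

/-- The error made when the law after `t` steps of the chain `P` is replaced by `ν` in the
expectation of `f`, as a function of the starting point. With `ν` stationary these functions are
the terms of the solution of the Poisson equation for `f`. -/
noncomputable def mixingError (P : Kernel α α) (ν : Measure α) (f : α → ℝ) (t : ℕ) (x : α) : ℝ :=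
  ∫ y, f y ∂(P ^ t) x - ∫ y, f y ∂ν

variable {P P' : Kernel α α} {μ ν : Measure α} {f : α → ℝ} {b : ℝ}

theorem measurable_mixingError (hf : Measurable f) (t : ℕ) : Measurable (mixingError P ν f t) :=
  (measurable_integral_kernel (P ^ t) hf).sub_const _

theorem abs_mixingError_le [IsProbabilityMeasure ν] [IsMarkovKernel P] (hf : Measurable f)
    (hb : ∀ x, |f x| ≤ b) {t : ℕ} {δ : ℝ} (hmix : ∀ x, tvDist ((P ^ t) x) ν ≤ δ) (x : α) :
    |mixingError P ν f t x| ≤ b * (2 * δ) :=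
  integralDistLE_of_tvDist_le (hmix x) f b hf hb

theorem integral_mixingError [IsMarkovKernel P] (hf : Measurable f) (hb : ∀ x, |f x| ≤ b) (t : ℕ)
    (x : α) : ∫ y, mixingError P ν f t y ∂P x = mixingError P ν f (t + 1) x := by
  simp only [mixingError]
  rw [integral_kernel_pow_succ P hf hb, integral_sub _ (integrable_const _)]
  · simp
  · exact integrable_of_measurable_of_abs_le (measurable_integral_kernel (P ^ t) hf)
      fun x => abs_integral_le_of_abs_le hb

theorem abs_integral_mixingError_sub_succ_le [IsProbabilityMeasure μ] [IsProbabilityMeasure ν]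
    [IsMarkovKernel P] [IsMarkovKernel P'] (hμ : P'.Invariant μ) {ε : ℝ}
    (hP : KernelDistLE P' P ε) {δ : ℕ → ℝ} (hmix : ∀ t x, tvDist ((P ^ t) x) ν ≤ δ t)
    (hf : Measurable f) (hb : ∀ x, |f x| ≤ b) (t : ℕ) :
    |∫ x, mixingError P ν f t x ∂μ - ∫ x, mixingError P ν f (t + 1) x ∂μ| ≤
      b * (2 * δ t) * ε := by
  have hm : ∀ t, Measurable (mixingError P ν f t) := measurable_mixingError hf
  have hbd : ∀ t x, |mixingError P ν f t x| ≤ b * (2 * δ t) := fun t =>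
    abs_mixingError_le hf hb (hmix t)
  rw [← integral_of_invariant hμ (hm t) (hbd t), ← integral_sub
    (integrable_of_measurable_of_abs_le (measurable_integral_kernel P' (hm t))
      fun x => abs_integral_le_of_abs_le (hbd t))
    (integrable_of_measurable_of_abs_le (hm (t + 1)) (hbd (t + 1)))]
  refine abs_integral_le_of_abs_le fun x => ?_
  rw [← integral_mixingError hf hb]
  exact hP x _ _ (hm t) (hbd t)

theorem integralDistLE_of_invariant [IsProbabilityMeasure μ] [IsProbabilityMeasure ν]
    [IsMarkovKernel P] [IsMarkovKernel P'] (hμ : P'.Invariant μ) {ε : ℝ}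
    (hP : KernelDistLE P' P ε) {δ : ℕ → ℝ} (hδ : Summable δ)
    (hmix : ∀ t x, tvDist ((P ^ t) x) ν ≤ δ t) :
    IntegralDistLE μ ν (2 * (∑' t, δ t) * ε) := by
  intro f b hf hb
  have hlim : Tendsto (fun t => ∫ x, mixingError P ν f t x ∂μ) atTop (𝓝 0) :=
    squeeze_zero_norm
      (fun t => abs_integral_le_of_abs_le (abs_mixingError_le hf hb (hmix t)))
      (by simpa using (hδ.tendsto_atTop_zero.const_mul 2).const_mul b)
  have h := dist_le_tsum_of_dist_le_of_tendsto₀ (fun t => b * (2 * δ t) * ε)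
    (abs_integral_mixingError_sub_succ_le hμ hP hmix hf hb)
    (((hδ.mul_left 2).mul_left b).mul_right ε) hlim
  simp only [mixingError, integral_kernel_pow_zero P hf] at h
  rw [integral_sub (integrable_of_measurable_of_abs_le hf hb) (integrable_const _)] at h
  simpa [Real.dist_eq, tsum_mul_left, tsum_mul_right, mul_assoc] using h

end StationaryPerturbation

section Discounting

variable {γ : ℝ}

theorem hasSum_succ_mul_geometric (hγ₀ : 0 ≤ γ) (hγ₁ : γ < 1) :
    HasSum (fun t : ℕ => ((t : ℝ) + 1) * γ ^ t) ((1 - γ) ^ 2)⁻¹ := by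
  simpa using hasSum_choose_mul_geometric_of_norm_lt_one 1
    (show ‖γ‖ < 1 by rwa [Real.norm_of_nonneg hγ₀])

theorem summable_discounted (hγ₀ : 0 ≤ γ) (hγ₁ : γ < 1) {u : ℕ → ℝ} {b : ℝ}
    (hu : ∀ t, |u t| ≤ b) : Summable fun t => γ ^ t * u t := by
  refine Summable.of_norm_bounded ((summable_geometric_of_lt_one hγ₀ hγ₁).mul_right b) fun t => ?_
  rw [Real.norm_eq_abs, abs_mul, abs_of_nonneg (pow_nonneg hγ₀ t)]
  exact mul_le_mul_of_nonneg_left (hu t) (pow_nonneg hγ₀ t)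

theorem abs_tsum_discounted_le (hγ₀ : 0 ≤ γ) (hγ₁ : γ < 1) {u : ℕ → ℝ} {b : ℝ}
    (hu : ∀ t, |u t| ≤ b) : |∑' t, γ ^ t * u t| ≤ b * (1 - γ)⁻¹ := by
  rw [← Real.norm_eq_abs]
  refine tsum_of_norm_bounded ((hasSum_geometric_of_lt_one hγ₀ hγ₁).mul_left b) fun t => ?_
  rw [Real.norm_eq_abs, abs_mul, abs_of_nonneg (pow_nonneg hγ₀ t), mul_comm]
  exact mul_le_mul_of_nonneg_right (hu t) (pow_nonneg hγ₀ t)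

theorem abs_tsum_discounted_sub_le (hγ₀ : 0 ≤ γ) (hγ₁ : γ < 1) {u v : ℕ → ℝ} {b e : ℝ}
    (hu : ∀ t, |u t| ≤ b) (hv : ∀ t, |v t| ≤ b) (h : ∀ t, |u t - v t| ≤ (t + 1) * e) :
    |∑' t, γ ^ t * u t - ∑' t, γ ^ t * v t| ≤ ((1 - γ) ^ 2)⁻¹ * e := by
  rw [← (summable_discounted hγ₀ hγ₁ hu).tsum_sub (summable_discounted hγ₀ hγ₁ hv)]
  rw [← Real.norm_eq_abs]
  refine tsum_of_norm_bounded ((hasSum_succ_mul_geometric hγ₀ hγ₁).mul_right e) fun t => ?_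
  rw [← mul_sub, Real.norm_eq_abs, abs_mul, abs_of_nonneg (pow_nonneg hγ₀ t)]
  calc γ ^ t * |u t - v t| ≤ γ ^ t * ((t + 1) * e) :=
        mul_le_mul_of_nonneg_left (h t) (pow_nonneg hγ₀ t)
    _ = (t + 1) * γ ^ t * e := by ring

end Discounting

section Gradient

variable {α ι : Type*} [MeasurableSpace α]

theorem measurable_euclideanSpace_of_apply {f : α → EuclideanSpace ℝ ι}
    (hf : ∀ i, Measurable fun x => f x i) : Measurable f :=
  (WithLp.measurable_toLp 2 (ι → ℝ)).comp (measurable_pi_lambda _ hf)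

theorem measurable_gradient_of_measurable [Fintype ι] {f : α → EuclideanSpace ℝ ι → ℝ}
    (θ : EuclideanSpace ℝ ι) (hf : ∀ θ, Measurable fun x => f x θ)
    (hd : ∀ x, DifferentiableAt ℝ (f x) θ) : Measurable fun x => gradient (f x) θ := by
  classical
  refine measurable_euclideanSpace_of_apply fun i => ?_
  set e : EuclideanSpace ℝ ι := EuclideanSpace.single i (1 : ℝ) with he
  have hc : Tendsto (fun n : ℕ => ‖(n : ℝ)‖) atTop atTop := by
    simpa using tendsto_natCast_atTop_atTop (R := ℝ)
  have hcoord : ∀ x, gradient (f x) θ i = fderiv ℝ (f x) θ e := fun x => by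
    rw [← inner_gradient_left, he, EuclideanSpace.inner_single_right]
    simp
  refine measurable_of_tendsto_metrizable
    (f := fun (n : ℕ) x => (n : ℝ) • (f x (θ + (n : ℝ)⁻¹ • e) - f x θ))
    (fun n => ((hf _).sub (hf _)).const_smul (n : ℝ)) (tendsto_pi_nhds.2 fun x => ?_)
  rw [hcoord]
  exact (hd x).hasFDerivAt.lim e hc

end Gradient

namespace MDP

variable {d : ℕ} {S A : Type*} [MeasurableSpace S] [MeasurableSpace A] {M : MDP d S A}
  {Ur UΘ LΘ Uπ κ₀ κ γ UJ : ℝ} {dstat : Param d → Measure S} {J : Param d → ℝ}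

instance isMarkovKernel_act (M : MDP d S A) (θ : Param d) : IsMarkovKernel (M.act θ) := by
  unfold act
  infer_instance

instance isMarkovKernel_stateKernel (M : MDP d S A) (θ : Param d) :
    IsMarkovKernel (M.stateKernel θ) := by
  unfold stateKernel
  infer_instance

instance isMarkovKernel_pairKernel (M : MDP d S A) (θ : Param d) :
    IsMarkovKernel (M.pairKernel θ) := by
  unfold pairKernel
  infer_instance

theorem integral_act (M : MDP d S A) (θ : Param d) (s : S) {f : S × A → ℝ} (hf : Measurable f) :
    ∫ x, f x ∂(M.act θ s) = ∫ a, f (s, a) ∂(M.policy θ s) := by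
  rw [act, Kernel.prod_apply, Kernel.id_apply, Measure.dirac_prod,
    integral_map measurable_prodMk_left.aemeasurable hf.aestronglyMeasurable]

theorem integral_stateKernel (M : MDP d S A) (θ : Param d) (s : S) {f : S → ℝ} {b : ℝ}
    (hf : Measurable f) (hb : ∀ s, |f s| ≤ b) :
    ∫ s', f s' ∂(M.stateKernel θ s) = ∫ a, ∫ s', f s' ∂(M.trans (s, a)) ∂(M.policy θ s) := by
  rw [stateKernel, integral_kernel_comp _ _ hf hb,
    integral_act M θ s (measurable_integral_kernel M.trans hf)]

/-- The advantage function `A^{π_θ}(s,a) = Q^{π_θ}(s,a) - V^{π_θ}(s)`, the scalar factor of the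
scenario-based gradient. -/
noncomputable def advantage (M : MDP d S A) (γ : ℝ) (θ : Param d) (x : S × A) : ℝ :=
  M.Q γ θ x - M.V γ θ x.1

/-- Uniform bound for the scenario-based gradients. -/
noncomputable def gradBound (γ Ur UΘ : ℝ) : ℝ :=
  2 * (Ur * (1 - γ)⁻¹) * UΘ

/-- Lipschitz constant of the scenario-based gradients in the parameter. -/
noncomputable def gradLip (γ Ur UΘ LΘ Uπ : ℝ) : ℝ :=
  2 * (((1 - γ) ^ 2)⁻¹ * (Ur * (2 * Uπ))) * UΘ + 2 * (Ur * (1 - γ)⁻¹) * LΘ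

/-- Lipschitz constant of the policy gradient. The first summand accounts for the integrand, the
second one for the stationary state-action distribution. -/
noncomputable def policyGradLip (γ Ur UΘ LΘ Uπ κ₀ κ : ℝ) : ℝ :=
  gradLip γ Ur UΘ LΘ Uπ + gradBound γ Ur UΘ * ((2 * (κ₀ * κ * (1 - κ)⁻¹) + 1) * (2 * Uπ))

theorem gradBound_pos (hγ₁ : γ < 1) (hUr : 0 < Ur) (hUΘ : 0 < UΘ) : 0 < gradBound γ Ur UΘ := by
  have : 0 < 1 - γ := sub_pos.2 hγ₁
  unfold gradBound
  positivity

theorem gradLip_pos (hγ₁ : γ < 1) (hUr : 0 < Ur) (hUΘ : 0 < UΘ) (hLΘ : 0 < LΘ) (hUπ : 0 < Uπ) :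
    0 < gradLip γ Ur UΘ LΘ Uπ := by
  have : 0 < 1 - γ := sub_pos.2 hγ₁
  unfold gradLip
  positivity

theorem policyGradLip_pos (hγ₁ : γ < 1) (hUr : 0 < Ur) (hUΘ : 0 < UΘ) (hLΘ : 0 < LΘ)
    (hUπ : 0 < Uπ) (hκ₀ : 0 ≤ κ₀) (hκ : 0 ≤ κ) (hκ₁ : κ < 1) :
    0 < policyGradLip γ Ur UΘ LΘ Uπ κ₀ κ := by
  have := gradBound_pos hγ₁ hUr hUΘ
  have := gradLip_pos hγ₁ hUr hUΘ hLΘ hUπ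
  have : 0 < 1 - κ := sub_pos.2 hκ₁
  unfold policyGradLip
  positivity

theorem measurable_Q (M : MDP d S A) (γ : ℝ) (θ : Param d) : Measurable (M.Q γ θ) :=
  Measurable.tsum fun t =>
    (measurable_integral_kernel (M.pairKernel θ ^ t) M.measurable_reward).const_mul _

theorem measurable_V (M : MDP d S A) (γ : ℝ) (θ : Param d) : Measurable (M.V γ θ) :=
  Measurable.tsum fun t =>
    (measurable_integral_kernel ((M.pairKernel θ ^ t) ∘ₖ M.act θ) M.measurable_reward).const_mul _

theorem measurable_advantage (M : MDP d S A) (γ : ℝ) (θ : Param d) : Measurable (M.advantage γ θ) :=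
  (M.measurable_Q γ θ).sub ((M.measurable_V γ θ).comp measurable_fst)

namespace Regular

theorem kernelDistLE_policy (h : M.Regular Ur UΘ LΘ Uπ) (θ₁ θ₂ : Param d) :
    KernelDistLE (M.policy θ₁) (M.policy θ₂) (2 * Uπ * ‖θ₁ - θ₂‖) := fun s => by
  rw [mul_assoc]
  exact integralDistLE_of_tvDist_le (h.policy_lipschitz s θ₁ θ₂)

theorem kernelDistLE_act (h : M.Regular Ur UΘ LΘ Uπ) (θ₁ θ₂ : Param d) :
    KernelDistLE (M.act θ₁) (M.act θ₂) (2 * Uπ * ‖θ₁ - θ₂‖) := by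
  intro s f b hf hb
  rw [integral_act _ _ _ hf, integral_act _ _ _ hf]
  exact h.kernelDistLE_policy θ₁ θ₂ s _ b (hf.comp measurable_prodMk_left) fun a => hb _

theorem kernelDistLE_stateKernel (h : M.Regular Ur UΘ LΘ Uπ) (θ₁ θ₂ : Param d) :
    KernelDistLE (M.stateKernel θ₁) (M.stateKernel θ₂) (2 * Uπ * ‖θ₁ - θ₂‖) := by
  simpa only [stateKernel, add_zero] using
    (KernelDistLE.refl M.trans).comp (h.kernelDistLE_act θ₁ θ₂)

theorem kernelDistLE_pairKernel (h : M.Regular Ur UΘ LΘ Uπ) (θ₁ θ₂ : Param d) :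
    KernelDistLE (M.pairKernel θ₁) (M.pairKernel θ₂) (2 * Uπ * ‖θ₁ - θ₂‖) := by
  simpa only [pairKernel, zero_add] using
    (h.kernelDistLE_act θ₁ θ₂).comp (KernelDistLE.refl M.trans)

theorem abs_Q_le (h : M.Regular Ur UΘ LΘ Uπ) (hγ₀ : 0 ≤ γ) (hγ₁ : γ < 1) (θ : Param d)
    (x : S × A) : |M.Q γ θ x| ≤ Ur * (1 - γ)⁻¹ :=
  abs_tsum_discounted_le hγ₀ hγ₁ fun _ => abs_integral_le_of_abs_le h.reward_le

theorem abs_V_le (h : M.Regular Ur UΘ LΘ Uπ) (hγ₀ : 0 ≤ γ) (hγ₁ : γ < 1) (θ : Param d) (s : S) :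
    |M.V γ θ s| ≤ Ur * (1 - γ)⁻¹ :=
  abs_tsum_discounted_le hγ₀ hγ₁ fun _ => abs_integral_le_of_abs_le h.reward_le

theorem abs_advantage_le (h : M.Regular Ur UΘ LΘ Uπ) (hγ₀ : 0 ≤ γ) (hγ₁ : γ < 1) (θ : Param d)
    (x : S × A) : |M.advantage γ θ x| ≤ 2 * (Ur * (1 - γ)⁻¹) := by
  refine (abs_sub _ _).trans ?_
  linarith [h.abs_Q_le hγ₀ hγ₁ θ x, h.abs_V_le hγ₀ hγ₁ θ x.1]

theorem abs_Q_sub_le (h : M.Regular Ur UΘ LΘ Uπ) (hγ₀ : 0 ≤ γ) (hγ₁ : γ < 1) (θ₁ θ₂ : Param d)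
    (x : S × A) :
    |M.Q γ θ₁ x - M.Q γ θ₂ x| ≤ ((1 - γ) ^ 2)⁻¹ * (Ur * (2 * Uπ * ‖θ₁ - θ₂‖)) := by
  have hP := h.kernelDistLE_pairKernel θ₁ θ₂
  have hnonneg : 0 ≤ Ur * (2 * Uπ * ‖θ₁ - θ₂‖) :=
    (abs_nonneg _).trans (hP x _ Ur M.measurable_reward h.reward_le)
  refine abs_tsum_discounted_sub_le hγ₀ hγ₁ (b := Ur)
    (fun _ => abs_integral_le_of_abs_le h.reward_le)
    (fun _ => abs_integral_le_of_abs_le h.reward_le) fun t => ?_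
  linarith [hP.pow t x _ Ur M.measurable_reward h.reward_le]

theorem abs_V_sub_le (h : M.Regular Ur UΘ LΘ Uπ) (hγ₀ : 0 ≤ γ) (hγ₁ : γ < 1) (θ₁ θ₂ : Param d)
    (s : S) : |M.V γ θ₁ s - M.V γ θ₂ s| ≤ ((1 - γ) ^ 2)⁻¹ * (Ur * (2 * Uπ * ‖θ₁ - θ₂‖)) := by
  refine abs_tsum_discounted_sub_le hγ₀ hγ₁ (b := Ur)
    (fun _ => abs_integral_le_of_abs_le h.reward_le)
    (fun _ => abs_integral_le_of_abs_le h.reward_le) fun t => ?_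
  refine (((h.kernelDistLE_pairKernel θ₁ θ₂).pow t).comp (h.kernelDistLE_act θ₁ θ₂) s _ Ur
    M.measurable_reward h.reward_le).trans_eq ?_
  ring

theorem abs_advantage_sub_le (h : M.Regular Ur UΘ LΘ Uπ) (hγ₀ : 0 ≤ γ) (hγ₁ : γ < 1)
    (θ₁ θ₂ : Param d) (x : S × A) :
    |M.advantage γ θ₁ x - M.advantage γ θ₂ x| ≤
      2 * (((1 - γ) ^ 2)⁻¹ * (Ur * (2 * Uπ * ‖θ₁ - θ₂‖))) := by
  rw [advantage, advantage, sub_sub_sub_comm]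
  refine (abs_sub _ _).trans ?_
  linarith [h.abs_Q_sub_le hγ₀ hγ₁ θ₁ θ₂ x, h.abs_V_sub_le hγ₀ hγ₁ θ₁ θ₂ x.1]

theorem differentiableAt_log_dens (h : M.Regular Ur UΘ LΘ Uπ) (x : S × A) (θ : Param d) :
    DifferentiableAt ℝ (fun θ' => Real.log (M.dens θ' x.1 x.2)) θ :=
  (h.differentiable x.1 x.2 θ).log (M.dens_pos θ x.1 x.2).ne'

theorem measurable_score (h : M.Regular Ur UΘ LΘ Uπ) (θ : Param d) : Measurable (M.score θ) := by
  refine measurable_gradient_of_measurable (f := fun x θ' => Real.log (M.dens θ' x.1 x.2)) θ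
    (fun θ' => Real.measurable_log.comp ?_) fun x => h.differentiableAt_log_dens x θ
  exact M.measurable_dens.comp (measurable_const.prodMk measurable_id)

theorem abs_log_dens_sub_le (h : M.Regular Ur UΘ LΘ Uπ) (θ₁ θ₂ : Param d) (x : S × A) :
    |Real.log (M.dens θ₁ x.1 x.2) - Real.log (M.dens θ₂ x.1 x.2)| ≤ UΘ * ‖θ₁ - θ₂‖ := by
  refine convex_univ.norm_image_sub_le_of_norm_fderiv_le (𝕜 := ℝ)
    (f := fun θ' => Real.log (M.dens θ' x.1 x.2))
    (fun θ _ => h.differentiableAt_log_dens x θ) (fun θ _ => ?_) (Set.mem_univ _) (Set.mem_univ _)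
  rw [← toDual_gradient, LinearIsometryEquiv.norm_map]
  exact h.score_le x θ

theorem norm_scenarioGrad_le (h : M.Regular Ur UΘ LΘ Uπ) (hγ₀ : 0 ≤ γ) (hγ₁ : γ < 1)
    (θ : Param d) (x : S × A) : ‖M.scenarioGrad γ θ x‖ ≤ gradBound γ Ur UΘ := by
  have hA := h.abs_advantage_le hγ₀ hγ₁ θ x
  rw [scenarioGrad, norm_smul]
  exact mul_le_mul hA (h.score_le x θ) (norm_nonneg _) ((abs_nonneg _).trans hA)

theorem norm_scenarioGrad_sub_le (h : M.Regular Ur UΘ LΘ Uπ) (hγ₀ : 0 ≤ γ) (hγ₁ : γ < 1)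
    (θ₁ θ₂ : Param d) (x : S × A) :
    ‖M.scenarioGrad γ θ₁ x - M.scenarioGrad γ θ₂ x‖ ≤ gradLip γ Ur UΘ LΘ Uπ * ‖θ₁ - θ₂‖ := by
  have hdiff := h.abs_advantage_sub_le hγ₀ hγ₁ θ₁ θ₂ x
  have hA := h.abs_advantage_le hγ₀ hγ₁ θ₂ x
  calc ‖M.scenarioGrad γ θ₁ x - M.scenarioGrad γ θ₂ x‖
      = ‖(M.advantage γ θ₁ x - M.advantage γ θ₂ x) • M.score θ₁ x +
          M.advantage γ θ₂ x • (M.score θ₁ x - M.score θ₂ x)‖ := by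
        congr 1
        simp only [scenarioGrad, advantage]
        module
    _ ≤ |M.advantage γ θ₁ x - M.advantage γ θ₂ x| * ‖M.score θ₁ x‖ +
          |M.advantage γ θ₂ x| * ‖M.score θ₁ x - M.score θ₂ x‖ := by
        exact (norm_add_le _ _).trans_eq
          (by rw [norm_smul, norm_smul, Real.norm_eq_abs, Real.norm_eq_abs])
    _ ≤ 2 * (((1 - γ) ^ 2)⁻¹ * (Ur * (2 * Uπ * ‖θ₁ - θ₂‖))) * UΘ +
          2 * (Ur * (1 - γ)⁻¹) * (LΘ * ‖θ₁ - θ₂‖) :=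
        add_le_add
          (mul_le_mul hdiff (h.score_le x θ₁) (norm_nonneg _) ((abs_nonneg _).trans hdiff))
          (mul_le_mul hA (h.score_lipschitz x θ₁ θ₂) (norm_nonneg _) ((abs_nonneg _).trans hA))
    _ = gradLip γ Ur UΘ LΘ Uπ * ‖θ₁ - θ₂‖ := by
        rw [gradLip]
        ring

theorem measurable_scenarioGrad (h : M.Regular Ur UΘ LΘ Uπ) (θ : Param d) :
    Measurable (M.scenarioGrad γ θ) :=
  (M.measurable_advantage γ θ).smul (h.measurable_score θ)

theorem measurable_uncurry_scenarioGrad (h : M.Regular Ur UΘ LΘ Uπ) (hγ₀ : 0 ≤ γ) (hγ₁ : γ < 1) :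
    Measurable fun z : Param d × (S × A) => M.scenarioGrad γ z.1 z.2 := by
  refine measurable_uncurry_of_continuous_of_measurable (u := M.scenarioGrad γ)
    (fun x => ?_) fun θ => h.measurable_scenarioGrad θ
  exact (LipschitzWith.of_dist_le' (K := gradLip γ Ur UΘ LΘ Uπ) fun θ₁ θ₂ => by
    simpa only [dist_eq_norm] using h.norm_scenarioGrad_sub_le hγ₀ hγ₁ θ₁ θ₂ x).continuous

end Regular

section Stationary

theorem integralDistLE_dstat (hreg : M.Regular Ur UΘ LΘ Uπ)
    (herg : M.UniformlyErgodic dstat κ₀ κ) (hκ : 0 ≤ κ) (hκ₁ : κ < 1) (θ₁ θ₂ : Param d) :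
    IntegralDistLE (dstat θ₁) (dstat θ₂)
      (2 * (κ₀ * κ * (1 - κ)⁻¹) * (2 * Uπ * ‖θ₁ - θ₂‖)) := by
  have := herg.isProbability
  have hsum : HasSum (fun t : ℕ => κ₀ * κ ^ (t + 1)) (κ₀ * κ * (1 - κ)⁻¹) := by
    simpa only [pow_succ', mul_assoc] using
      ((hasSum_geometric_of_lt_one hκ hκ₁).mul_left κ).mul_left κ₀
  rw [← hsum.tsum_eq]
  exact integralDistLE_of_invariant (herg.invariant θ₁) (hreg.kernelDistLE_stateKernel θ₁ θ₂)
    hsum.summable fun t s => herg.mixing θ₂ s (t + 1) (Nat.le_add_left 1 t)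

theorem norm_policyGrad_le (hreg : M.Regular Ur UΘ LΘ Uπ) (herg : M.UniformlyErgodic dstat κ₀ κ)
    (hγ₀ : 0 ≤ γ) (hγ₁ : γ < 1) (θ : Param d) :
    ‖M.policyGrad γ dstat θ‖ ≤ gradBound γ Ur UΘ := by
  have := herg.isProbability
  simpa [policyGrad] using norm_integral_le_of_norm_le_const (μ := dstat θ ⊗ₘ M.policy θ)
    (.of_forall (hreg.norm_scenarioGrad_le hγ₀ hγ₁ θ))

theorem integrable_scenarioGrad (hreg : M.Regular Ur UΘ LΘ Uπ) (hγ₀ : 0 ≤ γ) (hγ₁ : γ < 1)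
    (θ : Param d) (μ : Measure (S × A)) [IsFiniteMeasure μ] :
    Integrable (M.scenarioGrad γ θ) μ :=
  Integrable.of_bound (hreg.measurable_scenarioGrad θ).aestronglyMeasurable _
    (.of_forall (hreg.norm_scenarioGrad_le hγ₀ hγ₁ θ))

theorem norm_policyGrad_sub_le (hreg : M.Regular Ur UΘ LΘ Uπ)
    (herg : M.UniformlyErgodic dstat κ₀ κ) (hγ₀ : 0 ≤ γ) (hγ₁ : γ < 1) (hκ : 0 ≤ κ) (hκ₁ : κ < 1)
    (θ₁ θ₂ : Param d) :
    ‖M.policyGrad γ dstat θ₁ - M.policyGrad γ dstat θ₂‖ ≤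
      policyGradLip γ Ur UΘ LΘ Uπ κ₀ κ * ‖θ₁ - θ₂‖ := by
  have := herg.isProbability
  have hint := fun θ => integrable_scenarioGrad hreg hγ₀ hγ₁ θ (dstat θ₁ ⊗ₘ M.policy θ₁)
  have hgrad : ‖∫ x, M.scenarioGrad γ θ₁ x - M.scenarioGrad γ θ₂ x ∂(dstat θ₁ ⊗ₘ M.policy θ₁)‖ ≤
      gradLip γ Ur UΘ LΘ Uπ * ‖θ₁ - θ₂‖ := by
    simpa using norm_integral_le_of_norm_le_const (μ := dstat θ₁ ⊗ₘ M.policy θ₁)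
      (.of_forall (hreg.norm_scenarioGrad_sub_le hγ₀ hγ₁ θ₁ θ₂))
  have hdist := ((integralDistLE_dstat hreg herg hκ hκ₁ θ₁ θ₂).compProd
    (hreg.kernelDistLE_policy θ₁ θ₂)).norm_integral_sub_le
      (hreg.measurable_scenarioGrad (γ := γ) θ₂).stronglyMeasurable
      (hreg.norm_scenarioGrad_le hγ₀ hγ₁ θ₂)
  rw [integral_sub (hint θ₁) (hint θ₂)] at hgrad
  calc _ ≤ _ := norm_sub_le_norm_sub_add_norm_sub _
        (∫ x, M.scenarioGrad γ θ₂ x ∂(dstat θ₁ ⊗ₘ M.policy θ₁)) _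
    _ ≤ _ := add_le_add hgrad hdist
    _ = policyGradLip γ Ur UΘ LΘ Uπ κ₀ κ * ‖θ₁ - θ₂‖ := by
        rw [policyGradLip]
        ring

theorem IsObjective.gradient_eq (h : M.IsObjective γ dstat UJ J) (θ : Param d) :
    gradient J θ = M.policyGrad γ dstat θ :=
  (h.hasGradientAt θ).gradient

end Stationary

end MDP

section ConditionalLaw

variable {Ω β δ : Type*} {m mΩ : MeasurableSpace Ω} [MeasurableSpace β] [MeasurableSpace δ]
  {μ : Measure Ω} [IsProbabilityMeasure μ]

theorem setIntegral_measureReal_eq_of_condExp_eq (hm : m ≤ mΩ) {s : Set Ω}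
    (hs : MeasurableSet[m] s) {E : Set Ω} (hE : MeasurableSet E) {p : Ω → ℝ}
    (hp : μ[E.indicator (fun _ => (1 : ℝ)) | m] =ᵐ[μ] p) :
    ∫ ω in s, p ω ∂μ = μ.real (s ∩ E) := by
  have hint : Integrable (E.indicator fun _ => (1 : ℝ)) μ := (integrable_const 1).indicator hE
  rw [← setIntegral_congr_ae (hm s hs) (hp.mono fun ω h _ => h), setIntegral_condExp hm hint hs,
    setIntegral_indicator hE, setIntegral_const, smul_eq_mul, mul_one]

/-- A version of disintegration in which the conditioning `σ`-algebra may be larger than the one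
generated by `Z`. -/
theorem map_prodMk_eq_compProd (hm : m ≤ mΩ) {Z : Ω → β} (hZ : Measurable[m] Z) {Y : Ω → δ}
    (hY : Measurable Y) (κ : Kernel β δ) [IsMarkovKernel κ]
    (hlaw : ∀ D : Set δ, MeasurableSet D →
      μ[Set.indicator {ω | Y ω ∈ D} (fun _ => (1 : ℝ)) | m] =ᵐ[μ] fun ω => (κ (Z ω)).real D) :
    μ.map (fun ω => (Z ω, Y ω)) = μ.map Z ⊗ₘ κ := by
  have hZ' : Measurable Z := hZ.mono hm le_rfl
  have := Measure.isProbabilityMeasure_map (μ := μ) hZ'.aemeasurable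
  have := Measure.isProbabilityMeasure_map (μ := μ) (hZ'.prodMk hY).aemeasurable
  refine Measure.ext_prod fun {s t} hs ht => ?_
  have hcond : ∫ ω in Z ⁻¹' s, (κ (Z ω)).real t ∂μ = μ.real (Z ⁻¹' s ∩ Y ⁻¹' t) :=
    setIntegral_measureReal_eq_of_condExp_eq hm (hZ hs) (hY ht) (hlaw t ht)
  have hint : Integrable (fun ω => (κ (Z ω)).real t) (μ.restrict (Z ⁻¹' s)) :=
    integrable_of_measurable_of_abs_le (b := 1)
      ((κ.measurable_coe ht).comp hZ').ennreal_toReal fun ω => by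
        rw [abs_of_nonneg measureReal_nonneg]
        exact measureReal_le_one
  calc (μ.map fun ω => (Z ω, Y ω)) (s ×ˢ t) = μ (Z ⁻¹' s ∩ Y ⁻¹' t) := by
        rw [Measure.map_apply (hZ'.prodMk hY) (hs.prod ht)]
        rfl
    _ = ENNReal.ofReal (∫ ω in Z ⁻¹' s, (κ (Z ω)).real t ∂μ) := by rw [hcond, ofReal_measureReal]
    _ = ∫⁻ ω in Z ⁻¹' s, κ (Z ω) t ∂μ := by
        rw [ofReal_integral_eq_lintegral_ofReal hint (.of_forall fun ω => measureReal_nonneg)]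
        exact lintegral_congr fun ω => ofReal_measureReal
    _ = (μ.map Z ⊗ₘ κ) (s ×ˢ t) := by
        rw [Measure.compProd_apply_prod hs ht, setLIntegral_map hs (κ.measurable_coe ht) hZ']

end ConditionalLaw

namespace MDP

variable {d : ℕ} {S A : Type*} [MeasurableSpace S] [MeasurableSpace A]
  {M : MDP d S A} {Ur UΘ LΘ Uπ κ₀ κ : ℝ} {dstat : Param d → Measure S}

/-- The policy as a kernel in the parameter and the state together, for use with random
parameters. -/
noncomputable def jointPolicy (M : MDP d S A) : Kernel (Param d × S) A :=
  Kernel.withDensity (Kernel.const (Param d × S) M.actionRef)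
    fun p a => ((M.dens p.1 p.2 a).toNNReal : ℝ≥0∞)

theorem jointPolicy_apply (M : MDP d S A) (p : Param d × S) :
    M.jointPolicy p = M.policy p.1 p.2 := by
  have h : Measurable fun z : (Param d × S) × A => M.dens z.1.1 z.1.2 z.2 :=
    M.measurable_dens.comp (by fun_prop : Measurable fun z : (Param d × S) × A =>
      (z.1.1, z.1.2, z.2))
  rw [policy_apply, jointPolicy, Kernel.withDensity_apply _ h.real_toNNReal.coe_nnreal_ennreal]
  rfl

instance isMarkovKernel_jointPolicy (M : MDP d S A) : IsMarkovKernel M.jointPolicy :=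
  ⟨fun p => by
    rw [jointPolicy_apply]
    infer_instance⟩

/-- The law of the action and the next state, given the parameter and the state. -/
noncomputable def jointStep (M : MDP d S A) : Kernel (Param d × S) (A × S) :=
  M.jointPolicy ⊗ₖ M.trans.comap (fun z : (Param d × S) × A => (z.1.2, z.2)) (by fun_prop)

instance isMarkovKernel_jointStep (M : MDP d S A) : IsMarkovKernel M.jointStep := by
  unfold jointStep
  infer_instance

theorem jointStep_apply (M : MDP d S A) (p : Param d × S) :
    M.jointStep p = (M.policy p.1 ⊗ₖ M.trans) p.2 := by
  ext D hD
  rw [jointStep, Kernel.compProd_apply hD, Kernel.compProd_apply hD, jointPolicy_apply]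
  simp only [Kernel.comap_apply]

section IntegralJointStep

variable {b : ℝ}

theorem integral_jointStep (M : MDP d S A) (p : Param d × S) {f : A × S → ℝ}
    (hf : Measurable f) (hb : ∀ y, |f y| ≤ b) :
    ∫ y, f y ∂(M.jointStep p) =
      ∫ a, ∫ s', f (a, s') ∂(M.trans (p.2, a)) ∂(M.policy p.1 p.2) := by
  rw [jointStep_apply, integral_compProd (integrable_of_measurable_of_abs_le hf hb)]

theorem integral_jointStep_snd (M : MDP d S A) (p : Param d × S) {f : S → ℝ}
    (hf : Measurable f) (hb : ∀ s, |f s| ≤ b) :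
    ∫ y, f y.2 ∂(M.jointStep p) = ∫ s', f s' ∂(M.stateKernel p.1 p.2) := by
  rw [integral_jointStep M p (f := fun y => f y.2) (hf.comp measurable_snd) fun y => hb y.2,
    integral_stateKernel M p.1 p.2 hf hb]

theorem integral_jointStep_fst (M : MDP d S A) (p : Param d × S) {f : A → ℝ}
    (hf : Measurable f) (hb : ∀ a, |f a| ≤ b) :
    ∫ y, f y.1 ∂(M.jointStep p) = ∫ a, f a ∂(M.policy p.1 p.2) := by
  rw [integral_jointStep M p (f := fun y => f y.1) (hf.comp measurable_fst) fun y => hb y.1]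
  simp only [integral_const, probReal_univ, one_smul]

end IntegralJointStep

theorem Regular.integralDistLE_jointStep (h : M.Regular Ur UΘ LΘ Uπ) (θ₁ θ₂ : Param d) (s : S) :
    IntegralDistLE (M.jointStep (θ₁, s)) (M.jointStep (θ₂, s)) (2 * Uπ * ‖θ₁ - θ₂‖) := by
  intro f b hf hb
  have hm : Measurable fun z : S × A => ∫ s', f (z.2, s') ∂(M.trans z) :=
    measurable_integral_kernel_prod M.trans (f := fun z : (S × A) × S => f (z.1.2, z.2))
      (hf.comp (by fun_prop))
  rw [integral_jointStep M _ hf hb, integral_jointStep M _ hf hb]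
  exact h.kernelDistLE_policy θ₁ θ₂ s _ b (hm.comp measurable_prodMk_left) fun a =>
    abs_integral_le_of_abs_le fun s' => hb _

/-- The expectation of `F (θ, ·)` at the state-action pair which the chain under the fixed policy
`π_θ` reaches `t` steps after the state `s`, as a function of `(θ, s)`. -/
noncomputable def rollout (M : MDP d S A) (F : Param d × (S × A) → ℝ) : ℕ → Param d × S → ℝ
  | 0, p => ∫ y, F (p.1, (p.2, y.1)) ∂(M.jointStep p)
  | t + 1, p => ∫ y, rollout M F t (p.1, y.2) ∂(M.jointStep p)

section Rollout

variable {F : Param d × (S × A) → ℝ} {b : ℝ}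

theorem measurable_rollout (hF : Measurable F) (t : ℕ) : Measurable (M.rollout F t) := by
  induction t with
  | zero =>
    exact measurable_integral_kernel_prod M.jointStep
      (f := fun z : (Param d × S) × (A × S) => F (z.1.1, (z.1.2, z.2.1))) (hF.comp (by fun_prop))
  | succ t ih =>
    exact measurable_integral_kernel_prod M.jointStep
      (f := fun z : (Param d × S) × (A × S) => M.rollout F t (z.1.1, z.2.2))
      (ih.comp (by fun_prop))

theorem abs_rollout_le (hb : ∀ z, |F z| ≤ b) (t : ℕ) (p : Param d × S) :
    |M.rollout F t p| ≤ b := by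
  induction t generalizing p with
  | zero => exact abs_integral_le_of_abs_le fun y => hb _
  | succ t ih => exact abs_integral_le_of_abs_le fun y => ih _

theorem measurable_rollout_right (hF : Measurable F) (t : ℕ) (θ : Param d) :
    Measurable fun s => M.rollout F t (θ, s) :=
  (measurable_rollout hF t).comp measurable_prodMk_left

theorem rollout_eq_integral_pow (hF : Measurable F) (hb : ∀ z, |F z| ≤ b) (t : ℕ) (θ : Param d)
    (s : S) : M.rollout F t (θ, s) =
      ∫ s', M.rollout F 0 (θ, s') ∂((M.stateKernel θ ^ t) s) := by
  induction t generalizing s with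
  | zero => rw [integral_kernel_pow_zero _ (measurable_rollout_right hF 0 θ)]
  | succ t ih =>
    rw [integral_kernel_pow_succ _ (measurable_rollout_right hF 0 θ)
      fun s => abs_rollout_le hb 0 (θ, s), rollout,
      integral_jointStep_snd M (θ, s) (measurable_rollout_right hF t θ)
      fun s => abs_rollout_le hb t (θ, s)]
    exact integral_congr_ae (.of_forall ih)

theorem integral_rollout_zero (hF : Measurable F) (hb : ∀ z, |F z| ≤ b) (ν : Measure S)
    [IsFiniteMeasure ν] (θ : Param d) :
    ∫ s, M.rollout F 0 (θ, s) ∂ν = ∫ x, F (θ, x) ∂(ν ⊗ₘ M.policy θ) := by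
  have hFθ : Measurable fun x => F (θ, x) := hF.comp measurable_prodMk_left
  rw [Measure.integral_compProd (integrable_of_measurable_of_abs_le hFθ fun x => hb (θ, x))]
  refine integral_congr_ae (.of_forall fun s => ?_)
  exact integral_jointStep_fst M (θ, s) (hFθ.comp measurable_prodMk_left) fun a => hb (θ, (s, a))

theorem abs_rollout_sub_le (herg : M.UniformlyErgodic dstat κ₀ κ) (hF : Measurable F)
    (hb : ∀ z, |F z| ≤ b) (t : ℕ) (θ : Param d) (s : S) :
    |M.rollout F t (θ, s) - ∫ x, F (θ, x) ∂(dstat θ ⊗ₘ M.policy θ)| ≤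
      b * (2 * (κ₀ * κ ^ (t + 1))) := by
  have := herg.isProbability
  rw [← integral_rollout_zero hF hb, rollout_eq_integral_pow hF hb]
  exact integralDistLE_of_tvDist_le (herg.mixing θ s (t + 1) (Nat.le_add_left 1 t)) _ b
    (measurable_rollout_right hF 0 θ) fun s => abs_rollout_le hb 0 (θ, s)

end Rollout

end MDP

namespace IsPGVRER

variable {d : ℕ} {S A Ω : Type*} [MeasurableSpace S] [MeasurableSpace A]
  [mΩ : MeasurableSpace Ω] {M : MDP d S A} {γ : ℝ} {n : ℕ} {R : EstimatorKind}
  {Uf c η₁ r : ℝ} {B : ℕ → ℕ} {F₀ : Finset ℤ} {μ : Measure Ω} {ℱ : Filtration ℕ mΩ}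
  {X : Run d S A Ω} {Ur UΘ LΘ Uπ κ₀ κ : ℝ} {dstat : Param d → Measure S}

theorem measurable_param_stepIter (hX : IsPGVRER M γ n R Uf c η₁ r B F₀ μ ℱ X) (l : ℕ) :
    Measurable[ℱ l] (X.θ (stepIter n l)) :=
  (hX.param_adapted (l / n)).mono (ℱ.mono (Nat.mul_div_le l n)) le_rfl

theorem measurable_step (hX : IsPGVRER M γ n R Uf c η₁ r B F₀ μ ℱ X) (l : ℕ) :
    Measurable[ℱ (l + 1)] (X.step n l) := by
  have hs := (hX.state_adapted l).mono (ℱ.mono (Nat.le_succ l)) le_rfl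
  exact hs.prodMk (hX.action_adapted l)

theorem measurable_param_state (hX : IsPGVRER M γ n R Uf c η₁ r B F₀ μ ℱ X) {l : ℕ}
    {ϑ : Ω → Param d} (hϑ : Measurable[ℱ l] ϑ) : Measurable fun ω => (ϑ ω, (X.step n l ω).1) :=
  (hϑ.prodMk (hX.state_adapted l)).mono (ℱ.le l) le_rfl

section TrajectoryMixing

variable [IsProbabilityMeasure μ] {b ε : ℝ} {l : ℕ} {ϑ : Ω → Param d}

theorem map_step_eq_compProd (hX : IsPGVRER M γ n R Uf c η₁ r B F₀ μ ℱ X)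
    (hϑ : Measurable[ℱ l] ϑ) :
    μ.map (fun ω => ((ϑ ω, (X.θ (stepIter n l) ω, (X.step n l ω).1)),
        ((X.step n l ω).2, (X.step n (l + 1) ω).1))) =
      μ.map (fun ω => (ϑ ω, (X.θ (stepIter n l) ω, (X.step n l ω).1))) ⊗ₘ
        M.jointStep.comap Prod.snd measurable_snd := by
  have hY : Measurable fun ω => ((X.step n l ω).2, (X.step n (l + 1) ω).1) :=
    ((hX.action_adapted l).prodMk (hX.state_adapted (l + 1))).mono (ℱ.le _) le_rfl
  refine map_prodMk_eq_compProd (ℱ.le l)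
    (hϑ.prodMk ((hX.measurable_param_stepIter l).prodMk (hX.state_adapted l))) hY _ fun D hD => ?_
  simpa only [Kernel.comap_apply, MDP.jointStep_apply] using hX.law l D hD

theorem integral_step (hX : IsPGVRER M γ n R Uf c η₁ r B F₀ μ ℱ X) (hϑ : Measurable[ℱ l] ϑ)
    {f : (Param d × S) × (A × S) → ℝ} (hf : Measurable f) (hb : ∀ z, |f z| ≤ b) :
    ∫ ω, f ((ϑ ω, (X.step n l ω).1), ((X.step n l ω).2, (X.step n (l + 1) ω).1)) ∂μ =
      ∫ ω, ∫ y, f ((ϑ ω, (X.step n l ω).1), y)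
        ∂(M.jointStep (X.θ (stepIter n l) ω, (X.step n l ω).1)) ∂μ := by
  let Z : Ω → Param d × (Param d × S) := fun ω => (ϑ ω, (X.θ (stepIter n l) ω, (X.step n l ω).1))
  let Y : Ω → A × S := fun ω => ((X.step n l ω).2, (X.step n (l + 1) ω).1)
  let f' : (Param d × (Param d × S)) × (A × S) → ℝ := fun z => f ((z.1.1, z.1.2.2), z.2)
  have hZ : Measurable Z :=
    (hϑ.prodMk ((hX.measurable_param_stepIter l).prodMk (hX.state_adapted l))).mono (ℱ.le l) le_rfl
  have hY : Measurable Y :=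
    ((hX.action_adapted l).prodMk (hX.state_adapted (l + 1))).mono (ℱ.le _) le_rfl
  have hf' : Measurable f' := hf.comp (by fun_prop)
  have := Measure.isProbabilityMeasure_map (μ := μ) hZ.aemeasurable
  calc ∫ ω, f' (Z ω, Y ω) ∂μ = ∫ z, f' z ∂(μ.map fun ω => (Z ω, Y ω)) :=
        (integral_map (hZ.prodMk hY).aemeasurable hf'.aestronglyMeasurable).symm
    _ = ∫ z, ∫ y, f' (z, y) ∂(M.jointStep.comap Prod.snd measurable_snd z) ∂(μ.map Z) := by
        rw [hX.map_step_eq_compProd hϑ,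
          Measure.integral_compProd (integrable_of_measurable_of_abs_le hf' fun z => hb _)]
    _ = ∫ ω, ∫ y, f' (Z ω, y) ∂(M.jointStep.comap Prod.snd measurable_snd (Z ω)) ∂μ :=
        integral_map hZ.aemeasurable
          (measurable_integral_kernel_prod _ hf').aestronglyMeasurable

theorem abs_integral_step_sub_le (hX : IsPGVRER M γ n R Uf c η₁ r B F₀ μ ℱ X)
    (hreg : M.Regular Ur UΘ LΘ Uπ) (hUπ : 0 ≤ Uπ) (hϑ : Measurable[ℱ l] ϑ)
    (hε : ∀ ω, ‖X.θ (stepIter n l) ω - ϑ ω‖ ≤ ε)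
    {f : (Param d × S) × (A × S) → ℝ} (hf : Measurable f) (hb : ∀ z, |f z| ≤ b) :
    |∫ ω, f ((ϑ ω, (X.step n l ω).1), ((X.step n l ω).2, (X.step n (l + 1) ω).1)) ∂μ -
      ∫ ω, ∫ y, f ((ϑ ω, (X.step n l ω).1), y) ∂(M.jointStep (ϑ ω, (X.step n l ω).1)) ∂μ| ≤
      b * (2 * Uπ * ε) := by
  have hZ : Measurable fun ω => (ϑ ω, (X.θ (stepIter n l) ω, (X.step n l ω).1)) :=
    (hϑ.prodMk ((hX.measurable_param_stepIter l).prodMk (hX.state_adapted l))).mono (ℱ.le l) le_rfl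
  have hcur : Measurable fun ω => ∫ y, f ((ϑ ω, (X.step n l ω).1), y)
      ∂(M.jointStep (X.θ (stepIter n l) ω, (X.step n l ω).1)) :=
    (measurable_integral_kernel_prod (M.jointStep.comap Prod.snd measurable_snd)
      (f := fun z : (Param d × (Param d × S)) × (A × S) => f ((z.1.1, z.1.2.2), z.2))
      (hf.comp (by fun_prop))).comp hZ
  have hlag : Measurable fun ω => ∫ y, f ((ϑ ω, (X.step n l ω).1), y)
      ∂(M.jointStep (ϑ ω, (X.step n l ω).1)) :=
    (measurable_integral_kernel_prod M.jointStep hf).comp (hX.measurable_param_state hϑ)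
  have hbound := fun (p q : Param d × S) =>
    abs_integral_le_of_abs_le (μ := M.jointStep q) fun y => hb (p, y)
  rw [hX.integral_step hϑ hf hb,
    ← integral_sub (integrable_of_measurable_of_abs_le hcur fun ω => hbound _ _)
      (integrable_of_measurable_of_abs_le hlag fun ω => hbound _ _)]
  refine abs_integral_le_of_abs_le fun ω => ?_
  have hb₀ : 0 ≤ b := (abs_nonneg _).trans (hbound (ϑ ω, (X.step n l ω).1) (ϑ ω, (X.step n l ω).1))
  refine (hreg.integralDistLE_jointStep _ _ _ _ b (hf.comp measurable_prodMk_left)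
    fun y => hb _).trans ?_
  gcongr
  exact hε ω

variable {F : Param d × (S × A) → ℝ}

theorem integrable_rollout (hX : IsPGVRER M γ n R Uf c η₁ r B F₀ μ ℱ X) (hF : Measurable F)
    (hb : ∀ z, |F z| ≤ b) (hϑ : Measurable[ℱ l] ϑ) (t : ℕ) :
    Integrable (fun ω => M.rollout F t (ϑ ω, (X.step n l ω).1)) μ :=
  integrable_of_measurable_of_abs_le
    ((MDP.measurable_rollout hF t).comp (hX.measurable_param_state hϑ))
    fun _ => MDP.abs_rollout_le hb t _

theorem abs_integral_pair_sub_le (hX : IsPGVRER M γ n R Uf c η₁ r B F₀ μ ℱ X)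
    (hreg : M.Regular Ur UΘ LΘ Uπ) (hUπ : 0 ≤ Uπ) (hF : Measurable F) (hb : ∀ z, |F z| ≤ b)
    (hϑ : Measurable[ℱ l] ϑ) (hε : ∀ ω, ‖X.θ (stepIter n l) ω - ϑ ω‖ ≤ ε) :
    |∫ ω, F (ϑ ω, X.step n l ω) ∂μ - ∫ ω, M.rollout F 0 (ϑ ω, (X.step n l ω).1) ∂μ| ≤
      b * (2 * Uπ * ε) :=
  hX.abs_integral_step_sub_le hreg hUπ hϑ hε
    (f := fun z : (Param d × S) × (A × S) => F (z.1.1, (z.1.2, z.2.1)))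
    (hF.comp (by fun_prop)) fun _ => hb _

theorem abs_integral_rollout_sub_le (hX : IsPGVRER M γ n R Uf c η₁ r B F₀ μ ℱ X)
    (hreg : M.Regular Ur UΘ LΘ Uπ) (hUπ : 0 ≤ Uπ) (hF : Measurable F) (hb : ∀ z, |F z| ≤ b)
    (hϑ : Measurable[ℱ l] ϑ) (q t : ℕ)
    (hε : ∀ h, l ≤ h → h < l + t → ∀ ω, ‖X.θ (stepIter n h) ω - ϑ ω‖ ≤ ε) :
    |∫ ω, M.rollout F q (ϑ ω, (X.step n (l + t) ω).1) ∂μ -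
      ∫ ω, M.rollout F (q + t) (ϑ ω, (X.step n l ω).1) ∂μ| ≤ t * (b * (2 * Uπ * ε)) := by
  induction t generalizing q with
  | zero => simp
  | succ t ih =>
    have hstep := hX.abs_integral_step_sub_le hreg hUπ (l := l + t)
      (hϑ.mono (ℱ.mono (Nat.le_add_right l t)) le_rfl) (hε (l + t) (by omega) (by omega))
      (f := fun z : (Param d × S) × (A × S) => M.rollout F q (z.1.1, z.2.2))
      ((MDP.measurable_rollout hF q).comp (by fun_prop)) fun _ => MDP.abs_rollout_le hb q _
    have hind := ih (q + 1) fun h hl ht => hε h hl (by omega)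
    rw [show q + 1 + t = q + (t + 1) by ring] at hind
    calc _ ≤ _ := abs_sub_le _ (∫ ω, M.rollout F (q + 1) (ϑ ω, (X.step n (l + t) ω).1) ∂μ) _
      _ ≤ b * (2 * Uπ * ε) + t * (b * (2 * Uπ * ε)) := add_le_add hstep hind
      _ = _ := by
        push_cast
        ring

theorem abs_integral_sub_stationary_le (hX : IsPGVRER M γ n R Uf c η₁ r B F₀ μ ℱ X)
    (hreg : M.Regular Ur UΘ LΘ Uπ) (herg : M.UniformlyErgodic dstat κ₀ κ) (hUπ : 0 ≤ Uπ)
    (hF : Measurable F) (hb : ∀ z, |F z| ≤ b) (hϑ : Measurable[ℱ l] ϑ) (t : ℕ)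
    (hε : ∀ h, l ≤ h → h ≤ l + t → ∀ ω, ‖X.θ (stepIter n h) ω - ϑ ω‖ ≤ ε)
    {G : Param d → ℝ} (hG : Measurable G)
    (hFG : ∀ θ, ∫ x, F (θ, x) ∂(dstat θ ⊗ₘ M.policy θ) = G θ) :
    |∫ ω, F (ϑ ω, X.step n (l + t) ω) ∂μ - ∫ ω, G (ϑ ω) ∂μ| ≤
      (t + 1) * (b * (2 * Uπ * ε)) + b * (2 * (κ₀ * κ ^ (t + 1))) := by
  have := herg.isProbability
  have hGb : ∀ θ, |G θ| ≤ b := fun θ => by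
    rw [← hFG]
    exact abs_integral_le_of_abs_le fun x => hb _
  have hGϑ : Integrable (fun ω => G (ϑ ω)) μ :=
    integrable_of_measurable_of_abs_le (hG.comp (hϑ.mono (ℱ.le _) le_rfl)) fun ω => hGb _
  have hpair := hX.abs_integral_pair_sub_le hreg hUπ hF hb (l := l + t)
    (hϑ.mono (ℱ.mono (Nat.le_add_right l t)) le_rfl) (hε (l + t) (by omega) le_rfl)
  have hroll := hX.abs_integral_rollout_sub_le hreg hUπ hF hb hϑ 0 t
    fun h hl ht => hε h hl ht.le
  have hmix : |∫ ω, M.rollout F t (ϑ ω, (X.step n l ω).1) ∂μ - ∫ ω, G (ϑ ω) ∂μ| ≤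
      b * (2 * (κ₀ * κ ^ (t + 1))) := by
    rw [← integral_sub (hX.integrable_rollout hF hb hϑ t) hGϑ]
    refine abs_integral_le_of_abs_le fun ω => ?_
    rw [← hFG]
    exact MDP.abs_rollout_sub_le herg hF hb t _ _
  rw [zero_add] at hroll
  calc _ ≤ _ := abs_sub_le _ (∫ ω, M.rollout F 0 (ϑ ω, (X.step n (l + t) ω).1) ∂μ) _
    _ ≤ _ := add_le_add hpair
        ((abs_sub_le _ (∫ ω, M.rollout F t (ϑ ω, (X.step n l ω).1) ∂μ) _).trans
          (add_le_add hroll hmix))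
    _ = _ := by ring

end TrajectoryMixing

end IsPGVRER

section Weights

theorem abs_sub_le_mul_abs_log_sub {a b U : ℝ} (ha : 0 < a) (hb : 0 < b) (haU : a ≤ U)
    (hbU : b ≤ U) : |a - b| ≤ U * |Real.log a - Real.log b| := by
  wlog hab : b ≤ a generalizing a b
  · rw [abs_sub_comm, abs_sub_comm (Real.log a)]
    exact this hb ha hbU haU (le_of_not_ge hab)
  rw [abs_of_nonneg (sub_nonneg.2 hab),
    abs_of_nonneg (sub_nonneg.2 (Real.log_le_log hb hab)), ← Real.log_div ha.ne' hb.ne']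
  have hlog : 0 ≤ Real.log (a / b) := Real.log_nonneg ((one_le_div hb).2 hab)
  calc a - b = a * (1 - (a / b)⁻¹) := by field_simp
    _ ≤ a * Real.log (a / b) :=
        mul_le_mul_of_nonneg_left (Real.one_sub_inv_le_log_of_pos (div_pos ha hb)) ha.le
    _ ≤ U * Real.log (a / b) := mul_le_mul_of_nonneg_right haU hlog

theorem log_min {a b : ℝ} (ha : 0 < a) (hb : 0 < b) :
    Real.log (min a b) = min (Real.log a) (Real.log b) :=
  Real.strictMonoOn_log.monotoneOn.map_min ha hb

theorem abs_min_sub_min_one_le {f U : ℝ} (hf : 0 < f) (hU : 0 < U) :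
    |min f U - min 1 U| ≤ U * |Real.log f| := by
  refine (abs_sub_le_mul_abs_log_sub (lt_min hf hU) (lt_min one_pos hU) (min_le_right _ _)
    (min_le_right _ _)).trans (mul_le_mul_of_nonneg_left ?_ hU.le)
  rw [log_min hf hU, log_min one_pos hU, Real.log_one]
  simpa using abs_min_sub_min_le_max (Real.log f) (Real.log U) 0 (Real.log U)

end Weights

section TotalVariance

variable {Ω : Type*} [MeasurableSpace Ω] {d : ℕ}

theorem totalVariance_nonneg (Z : Ω → Param d) (μ : Measure Ω) : 0 ≤ totalVariance Z μ :=
  Finset.sum_nonneg fun _ _ => variance_nonneg _ _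

theorem totalVariance_const_smul (a : ℝ) (Z : Ω → Param d) (μ : Measure Ω) :
    totalVariance (fun ω => a • Z ω) μ = a ^ 2 * totalVariance Z μ := by
  simp only [totalVariance, PiLp.smul_apply, smul_eq_mul, variance_const_mul, Finset.mul_sum]

end TotalVariance

section LipschitzGradient

variable {E : Type*} [NormedAddCommGroup E] [InnerProductSpace ℝ E] [CompleteSpace E]
  {J : E → ℝ} {L : ℝ}

theorem continuous_gradient_of_lipschitz
    (hL : ∀ x y, ‖gradient J x - gradient J y‖ ≤ L * ‖x - y‖) : Continuous (gradient J) :=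
  (LipschitzWith.of_dist_le' (K := L) fun x y => by
    simpa only [dist_eq_norm] using hL x y).continuous

theorem add_inner_gradient_sub_le (hJ : Differentiable ℝ J) (hL₀ : 0 ≤ L)
    (hL : ∀ x y, ‖gradient J x - gradient J y‖ ≤ L * ‖x - y‖) (x y : E) :
    J x + inner ℝ (gradient J x) (y - x) - L * ‖y - x‖ ^ 2 ≤ J y := by
  have hderiv : ∀ z ∈ Metric.closedBall x ‖y - x‖, ‖fderiv ℝ J z - fderiv ℝ J x‖ ≤ L * ‖y - x‖ := by
    intro z hz
    rw [← toDual_gradient, ← toDual_gradient, ← map_sub, LinearIsometryEquiv.norm_map]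
    exact (hL z x).trans (mul_le_mul_of_nonneg_left (mem_closedBall_iff_norm.1 hz) hL₀)
  have hmean := (convex_closedBall x ‖y - x‖).norm_image_sub_le_of_norm_hasFDerivWithin_le'
    (fun z _ => (hJ z).hasFDerivAt.hasFDerivWithinAt) hderiv
    (Metric.mem_closedBall_self (norm_nonneg _)) (by simp [dist_eq_norm] : y ∈ _)
  rw [Real.norm_eq_abs] at hmean
  rw [inner_gradient_left]
  linarith [(abs_le.1 hmean).1, sq (‖y - x‖)]

end LipschitzGradient

/-- The learning rate `η₁ k^{-r}`; at `k = 0` it is `0` when `r ≠ 0`. -/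
noncomputable def learningRate (η₁ r : ℝ) (k : ℕ) : ℝ := η₁ * (k : ℝ) ^ (-r)

section LearningRate

variable {η₁ r : ℝ}

theorem learningRate_nonneg (hη : 0 ≤ η₁) (k : ℕ) : 0 ≤ learningRate η₁ r k := by
  unfold learningRate; positivity

theorem learningRate_pos (hη : 0 < η₁) {k : ℕ} (hk : 1 ≤ k) : 0 < learningRate η₁ r k := by
  have : (0 : ℝ) < k := by exact_mod_cast hk
  unfold learningRate; positivity

theorem learningRate_anti (hη : 0 ≤ η₁) (hr : 0 ≤ r) {p q : ℕ} (hp : 1 ≤ p) (hpq : p ≤ q) :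
    learningRate η₁ r q ≤ learningRate η₁ r p :=
  mul_le_mul_of_nonneg_left (Real.rpow_le_rpow_of_nonpos (by exact_mod_cast hp)
    (by exact_mod_cast hpq) (by linarith)) hη

theorem inv_learningRate (η₁ r : ℝ) (k : ℕ) :
    (learningRate η₁ r k)⁻¹ = η₁⁻¹ * (k : ℝ) ^ r := by
  rw [learningRate, mul_inv, Real.rpow_neg (Nat.cast_nonneg k), inv_inv]

theorem monotone_inv_learningRate (hη : 0 < η₁) (hr : 0 < r) :
    Monotone fun k => (learningRate η₁ r k)⁻¹ := by
  intro p q hpq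
  simp only [inv_learningRate]
  gcongr

theorem sub_one_rpow_le {x s : ℝ} (hx : 1 ≤ x) (hs₀ : 0 ≤ s) (hs₁ : s ≤ 1) :
    (x - 1) ^ s ≤ x ^ s - s * x ^ (s - 1) := by
  have hx₀ : 0 < x := by linarith
  have hinv : x⁻¹ ≤ 1 := inv_le_one_of_one_le₀ hx
  calc (x - 1) ^ s = x ^ s * (1 + -x⁻¹) ^ s := by
        rw [← Real.mul_rpow hx₀.le (by linarith), mul_add, mul_neg, mul_inv_cancel₀ hx₀.ne',
          mul_one, sub_eq_add_neg]
    _ ≤ x ^ s * (1 + s * -x⁻¹) := mul_le_mul_of_nonneg_left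
        (rpow_one_add_le_one_add_mul_self (by linarith) hs₀ hs₁) (by positivity)
    _ = x ^ s - s * x ^ (s - 1) := by rw [Real.rpow_sub_one hx₀.ne']; ring

theorem sum_rpow_neg_le (hr₀ : 0 ≤ r) (hr₁ : r < 1) (K : ℕ) :
    ∑ k ∈ Finset.Icc 1 K, (k : ℝ) ^ (-r) ≤ (1 - r)⁻¹ * (K : ℝ) ^ (1 - r) := by
  have hr : 0 < 1 - r := by linarith
  rw [le_inv_mul_iff₀ hr]
  induction K with
  | zero => simp [Real.zero_rpow hr.ne']
  | succ K ih =>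
    have hstep := sub_one_rpow_le (x := ((K + 1 : ℕ) : ℝ)) (s := 1 - r) (by simp) hr.le
      (by linarith)
    rw [show ((K + 1 : ℕ) : ℝ) - 1 = K by push_cast; ring, show 1 - r - 1 = -r by ring] at hstep
    rw [Finset.sum_Icc_succ_top (Nat.le_add_left 1 K), mul_add]
    linarith

theorem sum_learningRate_le (hη : 0 < η₁) (hr₀ : 0 ≤ r) (hr₁ : r < 1) (K : ℕ) :
    ∑ k ∈ Finset.Icc 1 K, learningRate η₁ r k ≤ η₁ * ((1 - r)⁻¹ * (K : ℝ) ^ (1 - r)) := by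
  simp only [learningRate, ← Finset.mul_sum]
  exact mul_le_mul_of_nonneg_left (sum_rpow_neg_le hr₀ hr₁ K) hη.le

-- Abel summation: the increments of `β` are nonnegative and each multiplies `a k + U ≥ 0`.
theorem sum_Ioc_mul_sub_le_of_monotone {β a : ℕ → ℝ} {U : ℝ} (hβ : Monotone β)
    (hβ₀ : ∀ k, 0 ≤ β k) (ha : ∀ k, |a k| ≤ U) {N K : ℕ} (hNK : N ≤ K) :
    ∑ k ∈ Finset.Ioc N K, β k * (a (k + 1) - a k) ≤ β K * (2 * U) := by
  have hnonneg : ∀ k, 0 ≤ a k + U := fun k => by linarith [(abs_le.1 (ha k)).1]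
  have habel : ∑ k ∈ Finset.Ioc N K, β k * (a (k + 1) - a k) ≤ β K * (a (K + 1) + U) := by
    induction K, hNK using Nat.le_induction with
    | base => simpa using mul_nonneg (hβ₀ N) (hnonneg (N + 1))
    | succ K hNK ih =>
      rw [Finset.sum_Ioc_succ_top hNK]
      linarith [mul_le_mul_of_nonneg_right (hβ K.le_succ) (hnonneg (K + 1))]
  exact habel.trans
    (mul_le_mul_of_nonneg_left (by linarith [(abs_le.1 (ha (K + 1))).2]) (hβ₀ K))

theorem sum_Ioc_sub_le_sum_Icc {f : ℕ → ℝ} (hf : ∀ k, 0 ≤ f k) (N K : ℕ) :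
    ∑ k ∈ Finset.Ioc N K, f (k - N) ≤ ∑ k ∈ Finset.Icc 1 K, f k := by
  rw [← Finset.sum_image (g := fun k => k - N) (f := f) fun p hp q hq hpq => by
    simp only [Finset.coe_Ioc, Set.mem_Ioc] at hp hq hpq
    omega]
  refine Finset.sum_le_sum_of_subset_of_nonneg (fun k hk => ?_) fun k _ _ => hf k
  simp only [Finset.mem_image, Finset.mem_Ioc] at hk
  rw [Finset.mem_Icc]
  omega

theorem sum_le_of_ascent {a g : ℕ → ℝ} {U H E F : ℝ} (hη : 0 < η₁) (hr : 0 < r)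
    (ha : ∀ k, |a k| ≤ U) (hg : ∀ k, g k ≤ H) (hH : 0 ≤ H) (hE : 0 ≤ E) (hF : 0 ≤ F)
    {N K : ℕ} (hasc : ∀ k, N < k → k ≤ K → learningRate η₁ r k * g k ≤ a (k + 1) - a k +
      learningRate η₁ r k * (E * learningRate η₁ r (k - N) + F)) :
    ∑ k ∈ Finset.Icc 1 K, g k ≤ N * H + (learningRate η₁ r K)⁻¹ * (2 * U) +
      E * ∑ k ∈ Finset.Icc 1 K, learningRate η₁ r k + K * F := by
  have hnonneg : ∀ k, 0 ≤ learningRate η₁ r k := learningRate_nonneg hη.le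
  have hIoc : Finset.Ioc (min N K) K = Finset.Ioc N K := by
    ext k
    simp only [Finset.mem_Ioc]
    omega
  have hterm : ∀ k ∈ Finset.Ioc N K, g k ≤ (learningRate η₁ r k)⁻¹ * (a (k + 1) - a k) +
      (E * learningRate η₁ r (k - N) + F) := by
    intro k hk
    rw [Finset.mem_Ioc] at hk
    have hpos : 0 < learningRate η₁ r k := learningRate_pos hη (by omega)
    refine le_of_mul_le_mul_left ((hasc k hk.1 hk.2).trans_eq ?_) hpos
    rw [mul_add _ _ (_ + _), mul_inv_cancel_left₀ hpos.ne']
  have hearly : ∑ k ∈ Finset.Ioc 0 (min N K), g k ≤ N * H := by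
    refine (Finset.sum_le_card_nsmul _ _ H fun k _ => hg k).trans ?_
    rw [nsmul_eq_mul, Nat.card_Ioc, Nat.sub_zero]
    exact mul_le_mul_of_nonneg_right (by exact_mod_cast min_le_left N K) hH
  have hlate := Finset.sum_le_sum hterm
  have habel := sum_Ioc_mul_sub_le_of_monotone (monotone_inv_learningRate hη hr)
    (fun k => inv_nonneg.2 (hnonneg k)) ha (min_le_right N K)
  have hshift := mul_le_mul_of_nonneg_left (sum_Ioc_sub_le_sum_Icc hnonneg N K) hE
  have hcard : ((K - N : ℕ) : ℝ) * F ≤ K * F :=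
    mul_le_mul_of_nonneg_right (by exact_mod_cast Nat.sub_le K N) hF
  rw [Finset.sum_add_distrib, Finset.sum_add_distrib, Finset.sum_const, Nat.card_Ioc,
    nsmul_eq_mul, ← Finset.mul_sum] at hlate
  rw [hIoc] at habel
  rw [show Finset.Icc 1 K = Finset.Ioc 0 K from rfl] at hshift ⊢
  rw [← Finset.sum_Ioc_consecutive g (Nat.zero_le (min N K)) (min_le_right N K), hIoc]
  linarith

end LearningRate

section Average

variable {ι : Type*} {s : Finset ι}

theorem norm_average_le {E : Type*} [SeminormedAddCommGroup E] [NormedSpace ℝ E] {f : ι → E}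
    {C : ℝ} (hC : 0 ≤ C) (h : ∀ i ∈ s, ‖f i‖ ≤ C) : ‖(s.card : ℝ)⁻¹ • ∑ i ∈ s, f i‖ ≤ C := by
  rw [norm_smul, norm_inv, Real.norm_natCast]
  refine inv_mul_le_of_le_mul₀ (Nat.cast_nonneg _) hC ?_
  simpa using norm_sum_le_of_le s h

theorem le_average (hs : s.Nonempty) {f : ι → ℝ} {e : ℝ} (h : ∀ i ∈ s, e ≤ f i) :
    e ≤ (s.card : ℝ)⁻¹ * ∑ i ∈ s, f i := by
  rw [le_inv_mul_iff₀ (by exact_mod_cast hs.card_pos)]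
  simpa using Finset.card_nsmul_le_sum s f e h

end Average

/-- The likelihood ratios of the policies are at most `Uf`, as is required of the estimators without
clipping only. -/
def BoundedRatio {d : ℕ} {S A : Type*} [MeasurableSpace S] [MeasurableSpace A] (M : MDP d S A)
    (R : EstimatorKind) (Uf : ℝ) : Prop :=
  R = .LR → ∀ θ₁ θ₂ s a, M.dens θ₁ s a / M.dens θ₂ s a ≤ Uf

namespace MDP

section SampleWeight

variable {d : ℕ} {S A : Type*} [MeasurableSpace S] [MeasurableSpace A] {M : MDP d S A}
  {R : EstimatorKind} {Ur UΘ LΘ Uπ Uf : ℝ}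

/-- The weight at the target parameter `θ₁` of a sample `x` that was collected under `θ₂`. -/
noncomputable def sampleWeight (M : MDP d S A) (R : EstimatorKind) (Uf : ℝ) (θ₁ θ₂ : Param d)
    (x : S × A) : ℝ :=
  R.weight Uf (M.dens θ₁ x.1 x.2 / M.dens θ₂ x.1 x.2)

theorem sampleWeight_eq_min (h : BoundedRatio M R Uf) (θ₁ θ₂ : Param d) (x : S × A) :
    M.sampleWeight R Uf θ₁ θ₂ x = min (M.dens θ₁ x.1 x.2 / M.dens θ₂ x.1 x.2) Uf := by
  cases R with
  | LR => exact (min_eq_left (h rfl _ _ _ _)).symm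
  | CLR => rfl

theorem sampleWeight_self (h : BoundedRatio M R Uf) (θ : Param d) (x : S × A) :
    M.sampleWeight R Uf θ θ x = min 1 Uf := by
  rw [sampleWeight_eq_min h, div_self (M.dens_pos _ _ _).ne']

theorem abs_sampleWeight_le (h : BoundedRatio M R Uf) (hUf : 0 < Uf) (θ₁ θ₂ : Param d)
    (x : S × A) : |M.sampleWeight R Uf θ₁ θ₂ x| ≤ Uf := by
  rw [sampleWeight_eq_min h,
    abs_of_pos (lt_min (div_pos (M.dens_pos _ _ _) (M.dens_pos _ _ _)) hUf)]
  exact min_le_right _ _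

theorem abs_sampleWeight_sub_min_one_le (h : BoundedRatio M R Uf) (hUf : 0 < Uf)
    (hreg : M.Regular Ur UΘ LΘ Uπ) (θ₁ θ₂ : Param d) (x : S × A) :
    |M.sampleWeight R Uf θ₁ θ₂ x - min 1 Uf| ≤ Uf * (UΘ * ‖θ₁ - θ₂‖) := by
  rw [sampleWeight_eq_min h]
  refine (abs_min_sub_min_one_le (div_pos (M.dens_pos _ _ _) (M.dens_pos _ _ _)) hUf).trans
    (mul_le_mul_of_nonneg_left ?_ hUf.le)
  rw [Real.log_div (M.dens_pos _ _ _).ne' (M.dens_pos _ _ _).ne']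
  exact hreg.abs_log_dens_sub_le θ₁ θ₂ x

theorem measurable_sampleWeight (h : BoundedRatio M R Uf) :
    Measurable fun z : Param d × Param d × (S × A) => M.sampleWeight R Uf z.1 z.2.1 z.2.2 := by
  simp only [sampleWeight_eq_min h]
  exact ((M.measurable_dens.comp (by fun_prop :
    Measurable fun z : Param d × Param d × (S × A) => (z.1, z.2.2))).div
    (M.measurable_dens.comp measurable_snd)).min measurable_const

end SampleWeight

section Pairing

variable {d : ℕ} {S A : Type*} [MeasurableSpace S] [MeasurableSpace A] {M : MDP d S A}
  {R : EstimatorKind} {Ur UΘ LΘ Uπ Uf κ₀ κ γ UJ G L L₀ D : ℝ} {dstat : Param d → Measure S}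
  {J : Param d → ℝ}

/-- The inner product of the gradient of the objective with the scenario-based gradient, whose mean
under the stationary state-action law of `π_θ` is `‖∇J(θ)‖²`. -/
noncomputable def pairing (M : MDP d S A) (γ : ℝ) (J : Param d → ℝ) (z : Param d × (S × A)) : ℝ :=
  inner ℝ (gradient J z.1) (M.scenarioGrad γ z.1 z.2)

/-- The differentiable objective `J` has a gradient that is bounded by `G`, is `L`-Lipschitz and is
the stationary mean of the scenario-based gradients, which are bounded by `G` and `L₀`-Lipschitz in
the parameter. The convergence analysis depends on `J` and `γ` only through these properties. -/
structure SmoothObjective (M : MDP d S A) (γ : ℝ) (dstat : Param d → Measure S)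
    (J : Param d → ℝ) (G L L₀ : ℝ) : Prop where
  differentiable : Differentiable ℝ J
  norm_gradient_le : ∀ θ, ‖gradient J θ‖ ≤ G
  norm_scenarioGrad_le : ∀ θ x, ‖M.scenarioGrad γ θ x‖ ≤ G
  lipschitz_nonneg : 0 ≤ L
  gradient_lipschitz : ∀ θ₁ θ₂, ‖gradient J θ₁ - gradient J θ₂‖ ≤ L * ‖θ₁ - θ₂‖
  scenario_lipschitz_nonneg : 0 ≤ L₀
  scenarioGrad_lipschitz : ∀ θ₁ θ₂ x,
    ‖M.scenarioGrad γ θ₁ x - M.scenarioGrad γ θ₂ x‖ ≤ L₀ * ‖θ₁ - θ₂‖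
  measurable_scenarioGrad : Measurable fun z : Param d × (S × A) => M.scenarioGrad γ z.1 z.2
  integral_pairing : ∀ θ,
    ∫ x, M.pairing γ J (θ, x) ∂(dstat θ ⊗ₘ M.policy θ) = ‖gradient J θ‖ ^ 2

theorem IsObjective.integral_pairing (hobj : M.IsObjective γ dstat UJ J)
    (hreg : M.Regular Ur UΘ LΘ Uπ) (herg : M.UniformlyErgodic dstat κ₀ κ) (hγ₀ : 0 ≤ γ)
    (hγ₁ : γ < 1) (θ : Param d) :
    ∫ x, M.pairing γ J (θ, x) ∂(dstat θ ⊗ₘ M.policy θ) = ‖gradient J θ‖ ^ 2 := by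
  have := herg.isProbability
  simp only [pairing]
  rw [integral_inner (integrable_scenarioGrad hreg hγ₀ hγ₁ θ _),
    show ∫ x, M.scenarioGrad γ θ x ∂(dstat θ ⊗ₘ M.policy θ) = gradient J θ from
      (hobj.gradient_eq θ).symm, real_inner_self_eq_norm_sq]

theorem IsObjective.smoothObjective (hobj : M.IsObjective γ dstat UJ J)
    (hreg : M.Regular Ur UΘ LΘ Uπ) (herg : M.UniformlyErgodic dstat κ₀ κ) (hγ₀ : 0 ≤ γ)
    (hγ₁ : γ < 1) (hκ : 0 ≤ κ) (hκ₁ : κ < 1) (hL : 0 ≤ policyGradLip γ Ur UΘ LΘ Uπ κ₀ κ)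
    (hL₀ : 0 ≤ gradLip γ Ur UΘ LΘ Uπ) :
    M.SmoothObjective γ dstat J (gradBound γ Ur UΘ) (policyGradLip γ Ur UΘ LΘ Uπ κ₀ κ)
      (gradLip γ Ur UΘ LΘ Uπ) where
  differentiable θ := (hobj.hasGradientAt θ).differentiableAt
  norm_gradient_le θ := hobj.gradient_eq θ ▸ norm_policyGrad_le hreg herg hγ₀ hγ₁ θ
  norm_scenarioGrad_le := hreg.norm_scenarioGrad_le hγ₀ hγ₁
  lipschitz_nonneg := hL
  gradient_lipschitz θ₁ θ₂ := by
    rw [hobj.gradient_eq, hobj.gradient_eq]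
    exact norm_policyGrad_sub_le hreg herg hγ₀ hγ₁ hκ hκ₁ θ₁ θ₂
  scenario_lipschitz_nonneg := hL₀
  scenarioGrad_lipschitz := hreg.norm_scenarioGrad_sub_le hγ₀ hγ₁
  measurable_scenarioGrad := hreg.measurable_uncurry_scenarioGrad hγ₀ hγ₁
  integral_pairing := hobj.integral_pairing hreg herg hγ₀ hγ₁

namespace SmoothObjective

theorem bound_nonneg (hJ : M.SmoothObjective γ dstat J G L L₀) : 0 ≤ G :=
  (norm_nonneg _).trans (hJ.norm_gradient_le 0)

theorem measurable_gradient (hJ : M.SmoothObjective γ dstat J G L L₀) : Measurable (gradient J) :=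
  (continuous_gradient_of_lipschitz hJ.gradient_lipschitz).measurable

theorem measurable_pairing (hJ : M.SmoothObjective γ dstat J G L L₀) :
    Measurable (M.pairing γ J) :=
  (hJ.measurable_gradient.comp measurable_fst).inner hJ.measurable_scenarioGrad

theorem sq_norm_gradient_le (hJ : M.SmoothObjective γ dstat J G L L₀) (θ : Param d) :
    |‖gradient J θ‖ ^ 2| ≤ G ^ 2 := by
  rw [abs_of_nonneg (by positivity)]
  exact pow_le_pow_left₀ (norm_nonneg _) (hJ.norm_gradient_le θ) 2

theorem abs_pairing_le (hJ : M.SmoothObjective γ dstat J G L L₀) (z : Param d × (S × A)) :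
    |M.pairing γ J z| ≤ G ^ 2 := by
  rw [sq]
  exact (abs_real_inner_le_norm _ _).trans (mul_le_mul (hJ.norm_gradient_le _)
    (hJ.norm_scenarioGrad_le _ _) (norm_nonneg _) hJ.bound_nonneg)

theorem abs_pairing_sub_le (hJ : M.SmoothObjective γ dstat J G L L₀) (θ₁ θ₂ : Param d)
    (x : S × A) :
    |M.pairing γ J (θ₁, x) - M.pairing γ J (θ₂, x)| ≤ G * (L + L₀) * ‖θ₁ - θ₂‖ := by
  calc |M.pairing γ J (θ₁, x) - M.pairing γ J (θ₂, x)|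
      = |inner ℝ (gradient J θ₁ - gradient J θ₂) (M.scenarioGrad γ θ₁ x) +
          inner ℝ (gradient J θ₂) (M.scenarioGrad γ θ₁ x - M.scenarioGrad γ θ₂ x)| := by
        simp only [pairing, inner_sub_left, inner_sub_right]
        ring_nf
    _ ≤ ‖gradient J θ₁ - gradient J θ₂‖ * ‖M.scenarioGrad γ θ₁ x‖ +
          ‖gradient J θ₂‖ * ‖M.scenarioGrad γ θ₁ x - M.scenarioGrad γ θ₂ x‖ :=
        (abs_add_le _ _).trans
          (add_le_add (abs_real_inner_le_norm _ _) (abs_real_inner_le_norm _ _))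
    _ ≤ (L * ‖θ₁ - θ₂‖) * G + G * (L₀ * ‖θ₁ - θ₂‖) := by
        have := hJ.bound_nonneg
        have := hJ.lipschitz_nonneg
        gcongr
        · exact hJ.gradient_lipschitz θ₁ θ₂
        · exact hJ.norm_scenarioGrad_le θ₁ x
        · exact hJ.norm_gradient_le θ₂
        · exact hJ.scenarioGrad_lipschitz θ₁ θ₂ x
    _ = G * (L + L₀) * ‖θ₁ - θ₂‖ := by ring

theorem abs_sq_norm_gradient_sub_le (hJ : M.SmoothObjective γ dstat J G L L₀) (θ₁ θ₂ : Param d) :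
    |‖gradient J θ₁‖ ^ 2 - ‖gradient J θ₂‖ ^ 2| ≤ 2 * G * L * ‖θ₁ - θ₂‖ := by
  have hdist : |‖gradient J θ₁‖ - ‖gradient J θ₂‖| ≤ L * ‖θ₁ - θ₂‖ :=
    (abs_norm_sub_norm_le _ _).trans (hJ.gradient_lipschitz θ₁ θ₂)
  have := hJ.bound_nonneg
  calc |‖gradient J θ₁‖ ^ 2 - ‖gradient J θ₂‖ ^ 2|
      = (‖gradient J θ₁‖ + ‖gradient J θ₂‖) * |‖gradient J θ₁‖ - ‖gradient J θ₂‖| := by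
        rw [sq_sub_sq, abs_mul, abs_of_nonneg (by positivity)]
    _ ≤ (G + G) * (L * ‖θ₁ - θ₂‖) := by
        gcongr
        · exact hJ.norm_gradient_le θ₁
        · exact hJ.norm_gradient_le θ₂
    _ = 2 * G * L * ‖θ₁ - θ₂‖ := by ring

theorem le_sampleWeight_mul_pairing (hJ : M.SmoothObjective γ dstat J G L L₀)
    (hreg : M.Regular Ur UΘ LΘ Uπ) (hUΘ : 0 ≤ UΘ) (hUf : 0 < Uf) (hratio : BoundedRatio M R Uf)
    {θ₁ θ₂ θ₃ : Param d} (h₁₂ : ‖θ₁ - θ₂‖ ≤ D) (h₁₃ : ‖θ₁ - θ₃‖ ≤ D) (x : S × A) :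
    min 1 Uf * M.pairing γ J (θ₃, x) - (Uf * UΘ * G ^ 2 + G * (L + L₀)) * D ≤
      M.sampleWeight R Uf θ₁ θ₂ x * M.pairing γ J (θ₁, x) := by
  have hG := hJ.bound_nonneg
  have hLL : 0 ≤ L + L₀ := add_nonneg hJ.lipschitz_nonneg hJ.scenario_lipschitz_nonneg
  have hweight : |(M.sampleWeight R Uf θ₁ θ₂ x - min 1 Uf) * M.pairing γ J (θ₁, x)| ≤
      Uf * (UΘ * D) * G ^ 2 := by
    have hD : 0 ≤ D := (norm_nonneg _).trans h₁₂
    rw [abs_mul]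
    exact mul_le_mul ((abs_sampleWeight_sub_min_one_le hratio hUf hreg θ₁ θ₂ x).trans (by gcongr))
      (hJ.abs_pairing_le _) (abs_nonneg _) (by positivity)
  have hpairing : |min 1 Uf * (M.pairing γ J (θ₁, x) - M.pairing γ J (θ₃, x))| ≤
      1 * (G * (L + L₀) * D) := by
    rw [abs_mul, abs_of_pos (lt_min one_pos hUf)]
    gcongr
    · exact min_le_left _ _
    · exact (hJ.abs_pairing_sub_le θ₁ θ₃ x).trans (by gcongr)
  linarith [(abs_le.1 hweight).1, (abs_le.1 hpairing).1]

end SmoothObjective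

end Pairing

end MDP

theorem step_mul_add {d n j : ℕ} {S A Ω : Type*} (X : Run d S A Ω) (hj : j < n) (q : ℕ) :
    X.step n (n * q + j) = X.x (q + 1) j := by
  rw [Run.step, stepIter, Nat.mul_add_mod, Nat.mod_eq_of_lt hj,
    Nat.mul_add_div (Nat.zero_lt_of_lt hj), Nat.div_eq_of_lt hj, add_zero]

section Estimators

variable {d : ℕ} {S A Ω : Type*} [MeasurableSpace S] [MeasurableSpace A] {M : MDP d S A} {γ : ℝ}
  {n : ℕ} {R : EstimatorKind} {Uf c G : ℝ} {B : ℕ → ℕ} {F₀ : Finset ℤ} {X : Run d S A Ω}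

theorem inner_indivEstimator (J : Param d → ℝ) (i k : ℤ) (ω : Ω) :
    inner ℝ (gradient J (X.θ k ω)) (indivEstimator M γ n R Uf X i k ω) =
      (n : ℝ)⁻¹ * ∑ j ∈ Finset.range n, M.sampleWeight R Uf (X.θ k ω) (X.θ i ω) (X.x i j ω) *
        M.pairing γ J (X.θ k ω, X.x i j ω) := by
  simp only [indivEstimator, inner_smul_right, inner_sum, MDP.pairing, MDP.sampleWeight]

theorem norm_indivEstimator_le (hUf : 0 < Uf) (hratio : BoundedRatio M R Uf) (hG : 0 ≤ G)
    (hg : ∀ θ x, ‖M.scenarioGrad γ θ x‖ ≤ G) (i k : ℤ) (ω : Ω) :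
    ‖indivEstimator M γ n R Uf X i k ω‖ ≤ Uf * G := by
  have h := norm_average_le (s := Finset.range n) (C := Uf * G) (by positivity)
    (f := fun j => M.sampleWeight R Uf (X.θ k ω) (X.θ i ω) (X.x i j ω) •
      M.scenarioGrad γ (X.θ k ω) (X.x i j ω)) fun j _ => by
    rw [norm_smul]
    exact mul_le_mul (MDP.abs_sampleWeight_le hratio hUf _ _ _) (hg _ _) (norm_nonneg _) hUf.le
  rwa [Finset.card_range] at h

theorem indivEstimator_self (hratio : BoundedRatio M R Uf) (k : ℤ) :
    indivEstimator M γ n R Uf X k k = fun ω => min 1 Uf • pgEstimator M γ n X k ω := by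
  funext ω
  have hweight := fun x => MDP.sampleWeight_self hratio (X.θ k ω) x
  simp only [MDP.sampleWeight] at hweight
  simp only [indivEstimator, pgEstimator, hweight, ← Finset.smul_sum]
  rw [smul_comm]

variable [MeasurableSpace Ω] {μ : Measure Ω}

theorem norm_avgEstimator_le (hUf : 0 < Uf) (hratio : BoundedRatio M R Uf) (hG : 0 ≤ G)
    (hg : ∀ θ x, ‖M.scenarioGrad γ θ x‖ ≤ G) (k : ℕ) (ω : Ω) :
    ‖avgEstimator M γ n R Uf c B F₀ μ X k ω‖ ≤ Uf * G :=
  norm_average_le (by positivity) fun i _ => norm_indivEstimator_le hUf hratio hG hg i k ω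

theorem self_mem_reuseSet (hUf : 0 < Uf) (hc : 1 ≤ c) (hratio : BoundedRatio M R Uf)
    (hB : ∀ k, 1 ≤ B k) {k : ℕ} (hk : 1 ≤ k) :
    (k : ℤ) ∈ reuseSet M γ n R Uf c B F₀ μ X k := by
  have hBk := hB k
  simp only [reuseSet, buffer, Finset.mem_filter, Finset.mem_Ioc]
  refine ⟨⟨⟨by omega, le_rfl⟩, Or.inl (by omega)⟩, ?_⟩
  rw [indivEstimator_self hratio, totalVariance_const_smul]
  refine mul_le_mul_of_nonneg_right ?_ (totalVariance_nonneg _ _)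
  exact (pow_le_one₀ (le_min zero_le_one hUf.le) (min_le_left _ _)).trans hc

end Estimators

/-- The constant that controls the effect of the drift of the parameters on the inner product of the
gradient with a reused sample. -/
def biasConst (Uf UΘ G L L₀ : ℝ) : ℝ :=
  Uf * UΘ * G ^ 2 + G * (L + L₀) + 2 * G * L

/-- The bias, per unit of the learning rate, of a sample for a target parameter that is at most `N`
iterations younger than the parameter from which the chain has mixed for `m` iterations. The first
term is the drift of the parameters up to the target, the second one that of the chain while it
mixes. -/
def driftError (n : ℕ) (Uf UΘ Uπ G L L₀ : ℝ) (N m : ℕ) : ℝ :=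
  biasConst Uf UΘ G L L₀ * (N * (Uf * G)) + n * (m + 1) * (G ^ 2 * (2 * Uπ * (m * (Uf * G))))

theorem biasConst_nonneg {Uf UΘ G L L₀ : ℝ} (hUf : 0 ≤ Uf) (hUΘ : 0 ≤ UΘ) (hG : 0 ≤ G) (hL : 0 ≤ L)
    (hL₀ : 0 ≤ L₀) : 0 ≤ biasConst Uf UΘ G L L₀ := by
  unfold biasConst
  positivity

theorem driftError_nonneg {n N m : ℕ} {Uf UΘ Uπ G L L₀ : ℝ} (hUf : 0 ≤ Uf) (hUΘ : 0 ≤ UΘ)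
    (hUπ : 0 ≤ Uπ) (hG : 0 ≤ G) (hL : 0 ≤ L) (hL₀ : 0 ≤ L₀) :
    0 ≤ driftError n Uf UΘ Uπ G L L₀ N m := by
  have := biasConst_nonneg hUf hUΘ hG hL hL₀
  unfold driftError
  positivity

theorem driftError_mono {n N N' m : ℕ} {Uf UΘ Uπ G L L₀ : ℝ} (hUf : 0 ≤ Uf) (hUΘ : 0 ≤ UΘ)
    (hG : 0 ≤ G) (hL : 0 ≤ L) (hL₀ : 0 ≤ L₀) (hN : N ≤ N') :
    driftError n Uf UΘ Uπ G L L₀ N m ≤ driftError n Uf UΘ Uπ G L L₀ N' m := by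
  have := biasConst_nonneg hUf hUΘ hG hL hL₀
  unfold driftError
  gcongr

namespace IsPGVRER

variable {d : ℕ} {S A Ω : Type*} [MeasurableSpace S] [MeasurableSpace A] [mΩ : MeasurableSpace Ω]
  {M : MDP d S A} {γ : ℝ} {n : ℕ} {R : EstimatorKind} {Uf c η₁ r : ℝ} {B : ℕ → ℕ} {F₀ : Finset ℤ}
  {μ : Measure Ω} {ℱ : Filtration ℕ mΩ} {X : Run d S A Ω}
  {Ur UΘ LΘ Uπ κ₀ κ G L L₀ : ℝ} {dstat : Param d → Measure S} {J : Param d → ℝ}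

theorem measurable_param (hX : IsPGVRER M γ n R Uf c η₁ r B F₀ μ ℱ X) (q : ℕ) :
    Measurable (X.θ (q + 1)) :=
  (hX.param_adapted q).mono (ℱ.le _) le_rfl

theorem measurable_sample (hX : IsPGVRER M γ n R Uf c η₁ r B F₀ μ ℱ X) {j : ℕ} (hj : j < n)
    (q : ℕ) : Measurable (X.x (q + 1) j) := by
  rw [← step_mul_add X hj]
  exact (hX.measurable_step _).mono (ℱ.le _) le_rfl

theorem norm_param_succ_sub_le (hX : IsPGVRER M γ n R Uf c η₁ r B F₀ μ ℱ X) (hη : 0 ≤ η₁)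
    (hUf : 0 < Uf) (hratio : BoundedRatio M R Uf) (hG : 0 ≤ G)
    (hg : ∀ θ x, ‖M.scenarioGrad γ θ x‖ ≤ G) {k : ℕ} (hk : 1 ≤ k) (ω : Ω) :
    ‖X.θ (k + 1) ω - X.θ k ω‖ ≤ learningRate η₁ r k * (Uf * G) := by
  rw [hX.update k hk ω, add_sub_cancel_left, norm_smul, ← learningRate,
    Real.norm_of_nonneg (learningRate_nonneg hη k)]
  exact mul_le_mul_of_nonneg_left (norm_avgEstimator_le hUf hratio hG hg k ω)
    (learningRate_nonneg hη k)

theorem norm_param_add_sub_le (hX : IsPGVRER M γ n R Uf c η₁ r B F₀ μ ℱ X) (hη : 0 ≤ η₁)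
    (hr : 0 ≤ r) (hUf : 0 < Uf) (hratio : BoundedRatio M R Uf) (hG : 0 ≤ G)
    (hg : ∀ θ x, ‖M.scenarioGrad γ θ x‖ ≤ G) {p q : ℕ} (hpq : p ≤ q) (t : ℕ) (ω : Ω) :
    ‖X.θ ((q + t : ℕ) + 1) ω - X.θ (q + 1) ω‖ ≤ t * (learningRate η₁ r (p + 1) * (Uf * G)) := by
  induction t with
  | zero => simp
  | succ t ih =>
    have hstep : ‖X.θ ((q + (t + 1) : ℕ) + 1) ω - X.θ ((q + t : ℕ) + 1) ω‖ ≤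
        learningRate η₁ r (p + 1) * (Uf * G) := by
      refine (hX.norm_param_succ_sub_le hη hUf hratio hG hg (k := q + t + 1) (by omega) ω).trans ?_
      gcongr
      exact learningRate_anti hη hr (by omega) (by omega)
    calc ‖X.θ ((q + (t + 1) : ℕ) + 1) ω - X.θ (q + 1) ω‖
        ≤ ‖X.θ ((q + (t + 1) : ℕ) + 1) ω - X.θ ((q + t : ℕ) + 1) ω‖ +
            ‖X.θ ((q + t : ℕ) + 1) ω - X.θ (q + 1) ω‖ := norm_sub_le_norm_sub_add_norm_sub _ _ _
      _ ≤ learningRate η₁ r (p + 1) * (Uf * G) + t * (learningRate η₁ r (p + 1) * (Uf * G)) :=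
        add_le_add hstep ih
      _ = (t + 1 : ℕ) * (learningRate η₁ r (p + 1) * (Uf * G)) := by push_cast; ring

variable [IsProbabilityMeasure μ]

theorem integrable_pairing (hX : IsPGVRER M γ n R Uf c η₁ r B F₀ μ ℱ X)
    (hJ : M.SmoothObjective γ dstat J G L L₀) (p q : ℕ) {j : ℕ} (hj : j < n) :
    Integrable (fun ω => M.pairing γ J (X.θ (q + 1) ω, X.x (p + 1) j ω)) μ :=
  integrable_of_measurable_of_abs_le
    (hJ.measurable_pairing.comp ((hX.measurable_param q).prodMk (hX.measurable_sample hj p)))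
    fun _ => hJ.abs_pairing_le _

theorem integrable_sq_norm_gradient (hX : IsPGVRER M γ n R Uf c η₁ r B F₀ μ ℱ X)
    (hJ : M.SmoothObjective γ dstat J G L L₀) (q : ℕ) :
    Integrable (fun ω => ‖gradient J (X.θ (q + 1) ω)‖ ^ 2) μ :=
  integrable_of_measurable_of_abs_le
    ((hJ.measurable_gradient.comp (hX.measurable_param q)).norm.pow_const 2)
    fun _ => hJ.sq_norm_gradient_le _

theorem integrable_sampleWeight_mul_pairing (hX : IsPGVRER M γ n R Uf c η₁ r B F₀ μ ℱ X)
    (hJ : M.SmoothObjective γ dstat J G L L₀) (hUf : 0 < Uf) (hratio : BoundedRatio M R Uf)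
    (p q : ℕ) {j : ℕ} (hj : j < n) :
    Integrable (fun ω => M.sampleWeight R Uf (X.θ (q + 1) ω) (X.θ (p + 1) ω) (X.x (p + 1) j ω) *
      M.pairing γ J (X.θ (q + 1) ω, X.x (p + 1) j ω)) μ :=
  (hX.integrable_pairing hJ p q hj).bdd_mul
    ((MDP.measurable_sampleWeight hratio).comp ((hX.measurable_param q).prodMk
      ((hX.measurable_param p).prodMk (hX.measurable_sample hj p)))).aestronglyMeasurable
    (ae_of_all _ fun _ => MDP.abs_sampleWeight_le hratio hUf _ _ _)

theorem abs_integral_pairing_sub_le (hX : IsPGVRER M γ n R Uf c η₁ r B F₀ μ ℱ X)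
    (hreg : M.Regular Ur UΘ LΘ Uπ) (herg : M.UniformlyErgodic dstat κ₀ κ)
    (hJ : M.SmoothObjective γ dstat J G L L₀) (hη : 0 ≤ η₁) (hr : 0 ≤ r) (hUf : 0 < Uf)
    (hUπ : 0 ≤ Uπ) (hκ₀ : 0 ≤ κ₀) (hκ : 0 ≤ κ) (hκ₁ : κ ≤ 1) (hratio : BoundedRatio M R Uf)
    (p m : ℕ) {j : ℕ} (hj : j < n) :
    |∫ ω, M.pairing γ J (X.θ (p + 1) ω, X.x ((p + m : ℕ) + 1) j ω) ∂μ -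
        ∫ ω, ‖gradient J (X.θ (p + 1) ω)‖ ^ 2 ∂μ| ≤
      n * (m + 1) * (G ^ 2 * (2 * Uπ * (m * (learningRate η₁ r (p + 1) * (Uf * G))))) +
        2 * G ^ 2 * (κ₀ * κ ^ (n * m)) := by
  have hG := hJ.bound_nonneg
  have hδ : 0 ≤ learningRate η₁ r (p + 1) * (Uf * G) :=
    mul_nonneg (learningRate_nonneg hη _) (by positivity)
  have hdrift : ∀ l, n * p ≤ l → l ≤ n * p + (n * m + j) → ∀ ω,
      ‖X.θ (stepIter n l) ω - X.θ (p + 1) ω‖ ≤ m * (learningRate η₁ r (p + 1) * (Uf * G)) := by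
    intro l hle hlt ω
    have hn : 0 < n := by omega
    obtain ⟨t, ht⟩ := Nat.exists_eq_add_of_le
      ((Nat.le_div_iff_mul_le hn).2 (by linarith) : p ≤ l / n)
    have hlm : l / n < p + m + 1 := by
      rw [Nat.div_lt_iff_lt_mul hn]
      linarith
    rw [stepIter, ht]
    refine (hX.norm_param_add_sub_le hη hr hUf hratio hG hJ.norm_scenarioGrad_le le_rfl t ω).trans
      (mul_le_mul_of_nonneg_right ?_ hδ)
    exact_mod_cast (by omega : t ≤ m)
  have hstat := hX.abs_integral_sub_stationary_le hreg herg hUπ hJ.measurable_pairing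
    hJ.abs_pairing_le (hX.param_adapted p) (n * m + j) hdrift
    (hJ.measurable_gradient.norm.pow_const 2) hJ.integral_pairing
  rw [show n * p + (n * m + j) = n * (p + m) + j by ring, step_mul_add X hj] at hstat
  have hsteps : ((n * m + j : ℕ) : ℝ) + 1 ≤ n * (m + 1) := by
    exact_mod_cast (by rw [mul_add]; omega : n * m + j + 1 ≤ n * (m + 1))
  refine hstat.trans (add_le_add (mul_le_mul_of_nonneg_right hsteps (by positivity)) ?_)
  rw [mul_left_comm, ← mul_assoc]
  gcongr ?_ * (κ₀ * ?_)
  exact pow_le_pow_of_le_one hκ hκ₁ (by omega)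

theorem abs_integral_sq_norm_gradient_sub_le (hX : IsPGVRER M γ n R Uf c η₁ r B F₀ μ ℱ X)
    (hJ : M.SmoothObjective γ dstat J G L L₀) {D : ℝ} (p q : ℕ)
    (hD : ∀ ω, ‖X.θ (q + 1) ω - X.θ (p + 1) ω‖ ≤ D) :
    |∫ ω, ‖gradient J (X.θ (q + 1) ω)‖ ^ 2 ∂μ - ∫ ω, ‖gradient J (X.θ (p + 1) ω)‖ ^ 2 ∂μ| ≤
      2 * G * L * D := by
  rw [← integral_sub (hX.integrable_sq_norm_gradient hJ q) (hX.integrable_sq_norm_gradient hJ p)]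
  have := hJ.bound_nonneg
  have := hJ.lipschitz_nonneg
  refine abs_integral_le_of_abs_le fun ω => (hJ.abs_sq_norm_gradient_sub_le _ _).trans ?_
  gcongr
  exact hD ω

/-- The parameter of iteration `p + 1` serves as the reference: the current parameter and the one
that collected the sample are close to it, and the chain has mixed since. -/
theorem le_integral_sampleWeight_mul_pairing (hX : IsPGVRER M γ n R Uf c η₁ r B F₀ μ ℱ X)
    (hreg : M.Regular Ur UΘ LΘ Uπ) (herg : M.UniformlyErgodic dstat κ₀ κ)
    (hJ : M.SmoothObjective γ dstat J G L L₀) (hη : 0 ≤ η₁) (hr : 0 ≤ r) (hUf : 0 < Uf)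
    (hUΘ : 0 ≤ UΘ) (hUπ : 0 ≤ Uπ) (hκ₀ : 0 ≤ κ₀) (hκ : 0 ≤ κ) (hκ₁ : κ ≤ 1)
    (hratio : BoundedRatio M R Uf) (p m q : ℕ) {j : ℕ} (hj : j < n) :
    min 1 Uf * ∫ ω, ‖gradient J (X.θ ((p + m + q : ℕ) + 1) ω)‖ ^ 2 ∂μ -
        (driftError n Uf UΘ Uπ G L L₀ (m + q) m * learningRate η₁ r (p + 1) +
          2 * G ^ 2 * (κ₀ * κ ^ (n * m))) ≤
      ∫ ω, M.sampleWeight R Uf (X.θ ((p + m + q : ℕ) + 1) ω) (X.θ ((p + m : ℕ) + 1) ω)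
          (X.x ((p + m : ℕ) + 1) j ω) *
        M.pairing γ J (X.θ ((p + m + q : ℕ) + 1) ω, X.x ((p + m : ℕ) + 1) j ω) ∂μ := by
  have hG := hJ.bound_nonneg
  have hL := hJ.lipschitz_nonneg
  set δ := learningRate η₁ r (p + 1) * (Uf * G) with hδdef
  have hδ : 0 ≤ δ := mul_nonneg (learningRate_nonneg hη _) (by positivity)
  have hdrift {s : ℕ} (hs : p ≤ s) (t : ℕ) (ω : Ω) :=
    hX.norm_param_add_sub_le hη hr hUf hratio hG hJ.norm_scenarioGrad_le hs t ω
  have hsource : ∀ ω, ‖X.θ ((p + m + q : ℕ) + 1) ω - X.θ ((p + m : ℕ) + 1) ω‖ ≤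
      (m + q : ℕ) * δ := fun ω =>
    (hdrift (Nat.le_add_right p m) q ω).trans
      (mul_le_mul_of_nonneg_right (by exact_mod_cast Nat.le_add_left q m) hδ)
  have hreference : ∀ ω, ‖X.θ ((p + m + q : ℕ) + 1) ω - X.θ (p + 1) ω‖ ≤ (m + q : ℕ) * δ :=
    fun ω => add_assoc p m q ▸ hdrift le_rfl (m + q) ω
  have hint := (hX.integrable_pairing hJ (p + m) p hj).const_mul (min 1 Uf)
  have hweight := integral_mono (hint.sub (integrable_const _))
    (hX.integrable_sampleWeight_mul_pairing hJ hUf hratio (p + m) (p + m + q) hj) fun ω =>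
    hJ.le_sampleWeight_mul_pairing hreg hUΘ hUf hratio (hsource ω) (hreference ω) _
  simp only [Pi.sub_apply] at hweight
  rw [integral_sub hint (integrable_const _), integral_const_mul, integral_const, probReal_univ,
    one_smul] at hweight
  have hmixed := (abs_le.1 (hX.abs_integral_pairing_sub_le hreg herg hJ hη hr hUf hUπ hκ₀ hκ hκ₁
    hratio p m hj)).1
  have htarget := (abs_le.1 (hX.abs_integral_sq_norm_gradient_sub_le hJ p (p + m + q)
    hreference)).2
  set bias := 2 * G * L * ((m + q : ℕ) * δ) + n * (m + 1) * (G ^ 2 * (2 * Uπ * (m * δ))) +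
    2 * G ^ 2 * (κ₀ * κ ^ (n * m)) with hbias
  have hscaled : min 1 Uf * (∫ ω, ‖gradient J (X.θ ((p + m + q : ℕ) + 1) ω)‖ ^ 2 ∂μ - bias) ≤
      min 1 Uf * ∫ ω, M.pairing γ J (X.θ (p + 1) ω, X.x ((p + m : ℕ) + 1) j ω) ∂μ :=
    mul_le_mul_of_nonneg_left (by linarith) (le_min zero_le_one hUf.le)
  have hbias₁ : min 1 Uf * bias ≤ bias := mul_le_of_le_one_left (by positivity) (min_le_left _ _)
  have herr : (Uf * UΘ * G ^ 2 + G * (L + L₀)) * ((m + q : ℕ) * δ) + bias =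
      driftError n Uf UΘ Uπ G L L₀ (m + q) m * learningRate η₁ r (p + 1) +
        2 * G ^ 2 * (κ₀ * κ ^ (n * m)) := by
    rw [driftError, biasConst, hbias, hδdef]
    ring
  linarith

end IsPGVRER

section Reuse

variable {d : ℕ} {S A Ω : Type*} [MeasurableSpace S] [MeasurableSpace A] [MeasurableSpace Ω]
  {M : MDP d S A} {γ : ℝ} {n : ℕ} {R : EstimatorKind} {Uf c : ℝ} {B : ℕ → ℕ} {F₀ : Finset ℤ}
  {μ : Measure Ω} {X : Run d S A Ω}

theorem exists_eq_add_of_mem_reuseSet {k m N : ℕ} {i : ℤ} (hN : B k + m ≤ N) (hk : N < k)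
    (hi : i ∈ reuseSet M γ n R Uf c B F₀ μ X k) :
    ∃ p q : ℕ, i = (p + m : ℕ) + 1 ∧ (k : ℤ) = (p + m + q : ℕ) + 1 ∧ m + q ≤ N ∧
      1 ≤ k - N ∧ k - N ≤ p + 1 := by
  simp only [reuseSet, buffer, Finset.mem_filter, Finset.mem_Ioc] at hi
  exact ⟨(i - m - 1).toNat, (k - i).toNat, by omega, by omega, by omega, by omega, by omega⟩

theorem inner_avgEstimator (v : Param d) (k : ℕ) (ω : Ω) :
    inner ℝ v (avgEstimator M γ n R Uf c B F₀ μ X k ω) =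
      ((reuseSet M γ n R Uf c B F₀ μ X k).card : ℝ)⁻¹ *
        ∑ i ∈ reuseSet M γ n R Uf c B F₀ μ X k,
          inner ℝ v (indivEstimator M γ n R Uf X i k ω) := by
  simp only [avgEstimator, inner_smul_right, inner_sum]

end Reuse

namespace IsPGVRER

variable {d : ℕ} {S A Ω : Type*} [MeasurableSpace S] [MeasurableSpace A] [mΩ : MeasurableSpace Ω]
  {M : MDP d S A} {γ : ℝ} {n : ℕ} {R : EstimatorKind} {Uf c η₁ r : ℝ} {B : ℕ → ℕ} {F₀ : Finset ℤ}
  {μ : Measure Ω} {ℱ : Filtration ℕ mΩ} {X : Run d S A Ω}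
  {Ur UΘ LΘ Uπ κ₀ κ G L L₀ UJ : ℝ} {dstat : Param d → Measure S} {J : Param d → ℝ}

theorem add_inner_avgEstimator_sub_le (hX : IsPGVRER M γ n R Uf c η₁ r B F₀ μ ℱ X)
    (hJ : M.SmoothObjective γ dstat J G L L₀) (hη : 0 ≤ η₁) (hUf : 0 < Uf)
    (hratio : BoundedRatio M R Uf) {k : ℕ} (hk : 1 ≤ k) (ω : Ω) :
    J (X.θ k ω) + learningRate η₁ r k *
        inner ℝ (gradient J (X.θ k ω)) (avgEstimator M γ n R Uf c B F₀ μ X k ω) -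
      L * (learningRate η₁ r k * (Uf * G)) ^ 2 ≤ J (X.θ (k + 1 : ℕ) ω) := by
  have hascent := add_inner_gradient_sub_le hJ.differentiable hJ.lipschitz_nonneg
    hJ.gradient_lipschitz (X.θ k ω) (X.θ (k + 1) ω)
  have hstep := mul_le_mul_of_nonneg_left (pow_le_pow_left₀ (norm_nonneg _)
    (hX.norm_param_succ_sub_le hη hUf hratio hJ.bound_nonneg hJ.norm_scenarioGrad_le hk ω) 2)
    hJ.lipschitz_nonneg
  have hupdate : X.θ (k + 1) ω - X.θ k ω =
      learningRate η₁ r k • avgEstimator M γ n R Uf c B F₀ μ X k ω := by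
    rw [hX.update k hk ω, add_sub_cancel_left, learningRate]
  rw [hupdate] at hstep hascent
  rw [inner_smul_right] at hascent
  push_cast
  linarith

variable [IsProbabilityMeasure μ]

theorem integrable_inner_indivEstimator (hX : IsPGVRER M γ n R Uf c η₁ r B F₀ μ ℱ X)
    (hJ : M.SmoothObjective γ dstat J G L L₀) (hUf : 0 < Uf) (hratio : BoundedRatio M R Uf)
    (p q : ℕ) :
    Integrable (fun ω => inner ℝ (gradient J (X.θ (q + 1) ω))
      (indivEstimator M γ n R Uf X (p + 1) (q + 1) ω)) μ := by
  simp only [inner_indivEstimator]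
  exact (integrable_finsetSum _ fun j hj => hX.integrable_sampleWeight_mul_pairing hJ hUf hratio
    p q (Finset.mem_range.1 hj)).const_mul _

theorem le_integral_inner_indivEstimator (hX : IsPGVRER M γ n R Uf c η₁ r B F₀ μ ℱ X)
    (hn : 1 ≤ n) (hreg : M.Regular Ur UΘ LΘ Uπ) (herg : M.UniformlyErgodic dstat κ₀ κ)
    (hJ : M.SmoothObjective γ dstat J G L L₀) (hη : 0 ≤ η₁) (hr : 0 ≤ r) (hUf : 0 < Uf)
    (hUΘ : 0 ≤ UΘ) (hUπ : 0 ≤ Uπ) (hκ₀ : 0 ≤ κ₀) (hκ : 0 ≤ κ) (hκ₁ : κ ≤ 1)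
    (hratio : BoundedRatio M R Uf) (p m q : ℕ) :
    min 1 Uf * ∫ ω, ‖gradient J (X.θ ((p + m + q : ℕ) + 1) ω)‖ ^ 2 ∂μ -
        (driftError n Uf UΘ Uπ G L L₀ (m + q) m * learningRate η₁ r (p + 1) +
          2 * G ^ 2 * (κ₀ * κ ^ (n * m))) ≤
      ∫ ω, inner ℝ (gradient J (X.θ ((p + m + q : ℕ) + 1) ω))
        (indivEstimator M γ n R Uf X ((p + m : ℕ) + 1) ((p + m + q : ℕ) + 1) ω) ∂μ := by
  simp only [inner_indivEstimator]
  rw [integral_const_mul, integral_finsetSum _ fun j hj =>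
    hX.integrable_sampleWeight_mul_pairing hJ hUf hratio _ _ (Finset.mem_range.1 hj)]
  have h := le_average (Finset.nonempty_range_iff.2 (by omega)) fun j hj =>
    hX.le_integral_sampleWeight_mul_pairing hreg herg hJ hη hr hUf hUΘ hUπ hκ₀ hκ hκ₁ hratio p m q
      (Finset.mem_range.1 hj)
  rwa [Finset.card_range] at h

theorem integrable_inner_indivEstimator_of_mem_reuseSet
    (hX : IsPGVRER M γ n R Uf c η₁ r B F₀ μ ℱ X) (hJ : M.SmoothObjective γ dstat J G L L₀)
    (hUf : 0 < Uf) (hratio : BoundedRatio M R Uf) {k : ℕ} {i : ℤ} (hk : B k < k)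
    (hi : i ∈ reuseSet M γ n R Uf c B F₀ μ X k) :
    Integrable (fun ω => inner ℝ (gradient J (X.θ k ω)) (indivEstimator M γ n R Uf X i k ω)) μ := by
  obtain ⟨p, q, hip, hkq, -⟩ := exists_eq_add_of_mem_reuseSet (m := 0) le_rfl hk hi
  have h := hX.integrable_inner_indivEstimator hJ hUf hratio (p + 0) (p + 0 + q)
  rwa [← hip, ← hkq] at h

theorem le_integral_inner_indivEstimator_of_mem_reuseSet
    (hX : IsPGVRER M γ n R Uf c η₁ r B F₀ μ ℱ X) (hn : 1 ≤ n) (hreg : M.Regular Ur UΘ LΘ Uπ)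
    (herg : M.UniformlyErgodic dstat κ₀ κ) (hJ : M.SmoothObjective γ dstat J G L L₀)
    (hη : 0 ≤ η₁) (hr : 0 ≤ r) (hUf : 0 < Uf) (hUΘ : 0 ≤ UΘ) (hUπ : 0 ≤ Uπ) (hκ₀ : 0 ≤ κ₀)
    (hκ : 0 ≤ κ) (hκ₁ : κ ≤ 1) (hratio : BoundedRatio M R Uf) {k m N : ℕ} {i : ℤ}
    (hN : B k + m ≤ N) (hk : N < k) (hi : i ∈ reuseSet M γ n R Uf c B F₀ μ X k) :
    min 1 Uf * ∫ ω, ‖gradient J (X.θ k ω)‖ ^ 2 ∂μ -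
        (driftError n Uf UΘ Uπ G L L₀ N m * learningRate η₁ r (k - N) +
          2 * G ^ 2 * (κ₀ * κ ^ (n * m))) ≤
      ∫ ω, inner ℝ (gradient J (X.θ k ω)) (indivEstimator M γ n R Uf X i k ω) ∂μ := by
  have hG := hJ.bound_nonneg
  have hL := hJ.lipschitz_nonneg
  have hL₀ := hJ.scenario_lipschitz_nonneg
  obtain ⟨p, q, hip, hkq, hmq, hkN, hkp⟩ := exists_eq_add_of_mem_reuseSet hN hk hi
  have hdrift : driftError n Uf UΘ Uπ G L L₀ (m + q) m * learningRate η₁ r (p + 1) ≤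
      driftError n Uf UΘ Uπ G L L₀ N m * learningRate η₁ r (k - N) :=
    mul_le_mul (driftError_mono hUf.le hUΘ hG hL hL₀ hmq) (learningRate_anti hη hr hkN hkp)
      (learningRate_nonneg hη _) (driftError_nonneg hUf.le hUΘ hUπ hG hL hL₀)
  have h := hX.le_integral_inner_indivEstimator hn hreg herg hJ hη hr hUf hUΘ hUπ hκ₀ hκ hκ₁
    hratio p m q
  rw [← hip, ← hkq] at h
  linarith

theorem integrable_inner_avgEstimator (hX : IsPGVRER M γ n R Uf c η₁ r B F₀ μ ℱ X)
    (hJ : M.SmoothObjective γ dstat J G L L₀) (hUf : 0 < Uf) (hratio : BoundedRatio M R Uf) {k : ℕ}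
    (hk : B k < k) :
    Integrable (fun ω => inner ℝ (gradient J (X.θ k ω))
      (avgEstimator M γ n R Uf c B F₀ μ X k ω)) μ := by
  simp only [inner_avgEstimator]
  exact (integrable_finsetSum _ fun i hi =>
    hX.integrable_inner_indivEstimator_of_mem_reuseSet hJ hUf hratio hk hi).const_mul _

theorem le_integral_inner_avgEstimator (hX : IsPGVRER M γ n R Uf c η₁ r B F₀ μ ℱ X)
    (hn : 1 ≤ n) (hreg : M.Regular Ur UΘ LΘ Uπ) (herg : M.UniformlyErgodic dstat κ₀ κ)
    (hJ : M.SmoothObjective γ dstat J G L L₀) (hc : 1 ≤ c) (hη : 0 ≤ η₁) (hr : 0 ≤ r)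
    (hUf : 0 < Uf) (hUΘ : 0 ≤ UΘ) (hUπ : 0 ≤ Uπ) (hκ₀ : 0 ≤ κ₀) (hκ : 0 ≤ κ) (hκ₁ : κ ≤ 1)
    (hB : ∀ k, 1 ≤ B k) (hratio : BoundedRatio M R Uf) {k m N : ℕ} (hN : B k + m ≤ N)
    (hk : N < k) :
    min 1 Uf * ∫ ω, ‖gradient J (X.θ k ω)‖ ^ 2 ∂μ -
        (driftError n Uf UΘ Uπ G L L₀ N m * learningRate η₁ r (k - N) +
          2 * G ^ 2 * (κ₀ * κ ^ (n * m))) ≤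
      ∫ ω, inner ℝ (gradient J (X.θ k ω)) (avgEstimator M γ n R Uf c B F₀ μ X k ω) ∂μ := by
  have hmem : (k : ℤ) ∈ reuseSet M γ n R Uf c B F₀ μ X k :=
    self_mem_reuseSet hUf hc hratio hB (by omega)
  simp only [inner_avgEstimator]
  rw [integral_const_mul, integral_finsetSum _ fun i hi =>
    hX.integrable_inner_indivEstimator_of_mem_reuseSet hJ hUf hratio (by omega) hi]
  exact le_average ⟨_, hmem⟩ fun i hi => hX.le_integral_inner_indivEstimator_of_mem_reuseSet
    hn hreg herg hJ hη hr hUf hUΘ hUπ hκ₀ hκ hκ₁ hratio hN hk hi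

theorem integrable_objective (hX : IsPGVRER M γ n R Uf c η₁ r B F₀ μ ℱ X) (hJ : Continuous J)
    (hUJ : ∀ θ, |J θ| ≤ UJ) {k : ℕ} (hk : 1 ≤ k) : Integrable (fun ω => J (X.θ k ω)) μ := by
  obtain ⟨q, rfl⟩ := Nat.exists_eq_add_of_le' hk
  refine integrable_of_measurable_of_abs_le (hJ.measurable.comp ?_) fun _ => hUJ _
  exact_mod_cast hX.measurable_param q

theorem learningRate_mul_integral_sq_norm_gradient_le
    (hX : IsPGVRER M γ n R Uf c η₁ r B F₀ μ ℱ X) (hn : 1 ≤ n) (hreg : M.Regular Ur UΘ LΘ Uπ)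
    (herg : M.UniformlyErgodic dstat κ₀ κ) (hJ : M.SmoothObjective γ dstat J G L L₀)
    (hUJ : ∀ θ, |J θ| ≤ UJ) (hc : 1 ≤ c) (hη : 0 ≤ η₁) (hr : 0 ≤ r) (hUf : 0 < Uf)
    (hUΘ : 0 ≤ UΘ) (hUπ : 0 ≤ Uπ) (hκ₀ : 0 ≤ κ₀) (hκ : 0 ≤ κ) (hκ₁ : κ ≤ 1)
    (hB : ∀ k, 1 ≤ B k) (hratio : BoundedRatio M R Uf) {k m N : ℕ} (hN : B k + m ≤ N)
    (hk : N < k) :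
    learningRate η₁ r k * (min 1 Uf * ∫ ω, ‖gradient J (X.θ k ω)‖ ^ 2 ∂μ) ≤
      ∫ ω, J (X.θ (k + 1 : ℕ) ω) ∂μ - ∫ ω, J (X.θ k ω) ∂μ + learningRate η₁ r k *
        ((driftError n Uf UΘ Uπ G L L₀ N m + L * (Uf * G) ^ 2) * learningRate η₁ r (k - N) +
          2 * G ^ 2 * (κ₀ * κ ^ (n * m))) := by
  have hnonneg := learningRate_nonneg (r := r) hη k
  have hobj {q : ℕ} (hq : 1 ≤ q) := hX.integrable_objective hJ.differentiable.continuous hUJ hq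
  have hinner := (hX.integrable_inner_avgEstimator hJ hUf hratio (by omega : B k < k)).const_mul
    (learningRate η₁ r k)
  have hsum : Integrable (fun ω => J (X.θ k ω) + learningRate η₁ r k *
      inner ℝ (gradient J (X.θ k ω)) (avgEstimator M γ n R Uf c B F₀ μ X k ω)) μ :=
    (hobj (by omega)).add hinner
  have hascent := integral_mono (hsum.sub (integrable_const _)) (hobj (by omega : 1 ≤ k + 1))
    (hX.add_inner_avgEstimator_sub_le hJ hη hUf hratio (by omega))
  simp only [Pi.sub_apply] at hascent
  rw [integral_sub hsum (integrable_const _), integral_add (hobj (by omega)) hinner,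
    integral_const_mul, integral_const, probReal_univ, one_smul] at hascent
  have hestimator := mul_le_mul_of_nonneg_left (hX.le_integral_inner_avgEstimator hn hreg herg hJ
    hc hη hr hUf hUΘ hUπ hκ₀ hκ hκ₁ hB hratio hN hk) hnonneg
  have hquadratic : L * (learningRate η₁ r k * (Uf * G)) ^ 2 ≤
      learningRate η₁ r k * (L * (Uf * G) ^ 2 * learningRate η₁ r (k - N)) := by
    have hanti : learningRate η₁ r k ≤ learningRate η₁ r (k - N) :=
      learningRate_anti hη hr (by omega) (by omega)
    have := hJ.lipschitz_nonneg
    calc L * (learningRate η₁ r k * (Uf * G)) ^ 2 =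
          learningRate η₁ r k * (L * (Uf * G) ^ 2 * learningRate η₁ r k) := by ring
      _ ≤ learningRate η₁ r k * (L * (Uf * G) ^ 2 * learningRate η₁ r (k - N)) := by gcongr
  linarith

end IsPGVRER

section Rate

variable {κ r : ℝ} {n : ℕ}

theorem mixingLag_nonneg (hκ : 0 < κ) (hκ₁ : κ < 1) (hr : 0 ≤ r) (n : ℕ) {K : ℕ} (hK : 1 ≤ K) :
    0 ≤ mixingLag κ r n K := by
  have hK' : (1 : ℝ) ≤ K := by exact_mod_cast hK
  exact Real.logb_nonneg_of_base_lt_one hκ hκ₁ (by positivity)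
    (Real.rpow_le_one_of_one_le_of_nonpos hK' (neg_nonpos.2 (by positivity)))

theorem mixingLag_eq_mul_log (κ r : ℝ) (n : ℕ) {K : ℕ} (hK : 1 ≤ K) :
    mixingLag κ r n K = -(r / n) / Real.log κ * Real.log K := by
  have hK' : (0 : ℝ) < K := by exact_mod_cast hK
  rw [mixingLag, Real.logb, Real.log_rpow hK']
  ring

theorem pow_ceil_mixingLag_le (hκ : 0 < κ) (hκ₁ : κ < 1) (hn : 1 ≤ n) {K : ℕ} (hK : 1 ≤ K) :
    κ ^ (n * ⌈mixingLag κ r n K⌉₊) ≤ (K : ℝ) ^ (-r) := by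
  have hK' : (0 : ℝ) < K := by exact_mod_cast hK
  have hn' : (0 : ℝ) < n := by exact_mod_cast hn
  calc κ ^ (n * ⌈mixingLag κ r n K⌉₊) = κ ^ ((n : ℝ) * ⌈mixingLag κ r n K⌉₊) := by
        rw [← Real.rpow_natCast, Nat.cast_mul]
    _ ≤ κ ^ ((n : ℝ) * mixingLag κ r n K) := Real.rpow_le_rpow_of_exponent_ge hκ hκ₁.le
        (mul_le_mul_of_nonneg_left (Nat.le_ceil _) hn'.le)
    _ = (K : ℝ) ^ (-r) := by
        rw [mul_comm, Real.rpow_mul hκ.le, mixingLag, Real.rpow_logb hκ hκ₁.ne (by positivity),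
          ← Real.rpow_mul hK'.le, neg_mul, div_mul_cancel₀ _ hn'.ne']

theorem tendsto_log_pow_div_rpow (hr : 0 < r) (a : ℕ) :
    Tendsto (fun K : ℕ => Real.log K ^ a / (K : ℝ) ^ r) atTop (𝓝 0) := by
  have h := (isLittleO_log_rpow_rpow_atTop (a : ℝ) hr).tendsto_div_nhds_zero
  simp only [Real.rpow_natCast] at h
  exact h.comp tendsto_natCast_atTop_atTop

theorem tendsto_rate (hr₀ : 0 < r) (hr₁ : r < 1) (κ C : ℝ) (n : ℕ) {B : ℕ → ℕ}
    (hB : Tendsto (fun K : ℕ => (B K : ℝ) / (K : ℝ) ^ r) atTop (𝓝 0)) :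
    Tendsto (fun K : ℕ => C * (1 / (K : ℝ) ^ (1 - r) + mixingLag κ r n K ^ 2 / (K : ℝ) ^ r +
      (B K + mixingLag κ r n K) / (K : ℝ) ^ r)) atTop (𝓝 0) := by
  have hone := tendsto_log_pow_div_rpow (sub_pos.2 hr₁) 0
  have hsq := (tendsto_log_pow_div_rpow hr₀ 2).const_mul ((-(r / n) / Real.log κ) ^ 2)
  have hlog := (tendsto_log_pow_div_rpow hr₀ 1).const_mul (-(r / n) / Real.log κ)
  have h := ((hone.add hsq).add (hB.add hlog)).const_mul C
  simp only [mul_zero, add_zero] at h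
  refine h.congr' ?_
  filter_upwards [eventually_ge_atTop 1] with K hK
  rw [mixingLag_eq_mul_log κ r n hK]
  ring

theorem average_le_of_ascent {a g : ℕ → ℝ} {η₁ U H E F C D T : ℝ} {N K : ℕ} (hη : 0 < η₁)
    (hr₀ : 0 < r) (hr₁ : r < 1) (ha : ∀ k, |a k| ≤ U) (hg : ∀ k, g k ≤ H) (hH : 0 ≤ H) (hE : 0 ≤ E)
    (hF : 0 ≤ F) (hK : 1 ≤ K) (hT : 1 ≤ T) (hNT : N ≤ 2 * T) (hET : E ≤ C * T)
    (hFD : F ≤ D * (K : ℝ) ^ (-r))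
    (hasc : ∀ k, N < k → k ≤ K → learningRate η₁ r k * g k ≤ a (k + 1) - a k +
      learningRate η₁ r k * (E * learningRate η₁ r (k - N) + F)) :
    1 / (K : ℝ) * ∑ k ∈ Finset.Icc 1 K, g k ≤
      (2 * U * η₁⁻¹ + 2 * H + C * (η₁ * (1 - r)⁻¹) + D) *
        (1 / (K : ℝ) ^ (1 - r) + T / (K : ℝ) ^ r) := by
  have hK₁ : (1 : ℝ) ≤ K := by exact_mod_cast hK
  have hK₀ : (0 : ℝ) < K := by linarith
  have hr : 0 < 1 - r := by linarith
  have hU : 0 ≤ U := (abs_nonneg _).trans (ha 0)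
  have hsum := sum_le_of_ascent hη hr₀ ha hg hH hE hF hasc
  have hrates := mul_le_mul hET (sum_learningRate_le hη hr₀.le hr₁ K)
    (Finset.sum_nonneg fun k _ => learningRate_nonneg hη.le k) (hE.trans hET)
  rw [inv_learningRate] at hsum
  rw [Real.rpow_neg hK₀.le] at hFD
  set y : ℝ := (K : ℝ) ^ r with hy
  set z : ℝ := (K : ℝ) ^ (1 - r) with hz
  have hy₀ : 0 < y := by positivity
  have hz₁ : 1 ≤ z := Real.one_le_rpow hK₁ hr.le
  have hyz : (K : ℝ) = y * z := by rw [hy, hz, ← Real.rpow_add hK₀, add_sub_cancel, Real.rpow_one]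
  have hC : 0 ≤ C := nonneg_of_mul_nonneg_left (hE.trans hET) (by linarith)
  have hD : 0 ≤ D := nonneg_of_mul_nonneg_left (hF.trans hFD) (by positivity)
  have hinitial : N * H ≤ 2 * H * (T * z) := by
    calc N * H ≤ 2 * T * H := by gcongr
      _ ≤ 2 * T * H * z := le_mul_of_one_le_right (by positivity) hz₁
      _ = 2 * H * (T * z) := by ring
  have hbias : K * F ≤ D * (T * z) := by
    calc K * F ≤ K * (D * y⁻¹) := by gcongr
      _ = D * (1 * z) := by rw [hyz]; field_simp
      _ ≤ D * (T * z) := by gcongr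
  have hcoeff : 0 ≤ (2 * H + C * (η₁ * (1 - r)⁻¹) + D) * y := by positivity
  have hobjective : 0 ≤ 2 * U * η₁⁻¹ * (T * z) := by positivity
  calc 1 / (K : ℝ) * ∑ k ∈ Finset.Icc 1 K, g k ≤ 1 / K *
        ((2 * U * η₁⁻¹ + 2 * H + C * (η₁ * (1 - r)⁻¹) + D) * (y + T * z)) := by
        gcongr
        linarith
    _ = _ := by rw [hyz]; field_simp

/-- The factor by which `N + (m + 1)²` bounds the coefficient of the squared learning rates in the
ascent inequality, if the samples reach back `N` iterations and are compared with the stationary law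
`m` iterations earlier. -/
def driftConst (n : ℕ) (Uf UΘ Uπ G L L₀ : ℝ) : ℝ :=
  biasConst Uf UΘ G L L₀ * (Uf * G) + n * (G ^ 2 * (2 * Uπ * (Uf * G))) + L * (Uf * G) ^ 2

theorem driftConst_nonneg {Uf UΘ Uπ G L L₀ : ℝ} (hUf : 0 ≤ Uf) (hUΘ : 0 ≤ UΘ) (hUπ : 0 ≤ Uπ)
    (hG : 0 ≤ G) (hL : 0 ≤ L) (hL₀ : 0 ≤ L₀) : 0 ≤ driftConst n Uf UΘ Uπ G L L₀ := by
  have := biasConst_nonneg hUf hUΘ hG hL hL₀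
  unfold driftConst
  positivity

theorem driftError_add_le {Uf UΘ Uπ G L L₀ : ℝ} (hUf : 0 ≤ Uf) (hUΘ : 0 ≤ UΘ) (hUπ : 0 ≤ Uπ)
    (hG : 0 ≤ G) (hL : 0 ≤ L) (hL₀ : 0 ≤ L₀) {N : ℕ} (hN : 1 ≤ N) (m : ℕ) :
    driftError n Uf UΘ Uπ G L L₀ N m + L * (Uf * G) ^ 2 ≤
      driftConst n Uf UΘ Uπ G L L₀ * (N + (m + 1) ^ 2) := by
  have hbias := biasConst_nonneg hUf hUΘ hG hL hL₀
  have hN' : (1 : ℝ) ≤ N := by exact_mod_cast hN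
  have hsq : (0 : ℝ) ≤ (m + 1) ^ 2 := sq_nonneg _
  have hmul : ((m : ℝ) + 1) * m ≤ N + (m + 1) ^ 2 := by nlinarith
  calc driftError n Uf UΘ Uπ G L L₀ N m + L * (Uf * G) ^ 2 =
        biasConst Uf UΘ G L L₀ * (Uf * G) * N +
          n * (G ^ 2 * (2 * Uπ * (Uf * G))) * ((m + 1) * m) + L * (Uf * G) ^ 2 * 1 := by
        rw [driftError]; ring
    _ ≤ biasConst Uf UΘ G L L₀ * (Uf * G) * (N + (m + 1) ^ 2) +
          n * (G ^ 2 * (2 * Uπ * (Uf * G))) * (N + (m + 1) ^ 2) +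
          L * (Uf * G) ^ 2 * (N + (m + 1) ^ 2) := by
        gcongr <;> linarith
    _ = _ := by rw [driftConst]; ring

theorem add_sq_add_one_le {b m t : ℝ} (hb : 1 ≤ b) (hm : 0 ≤ m) (ht : 0 ≤ t) (hmt : m ≤ t + 1) :
    b + m + (m + 1) ^ 2 ≤ 10 * (t ^ 2 + (b + t)) := by
  nlinarith

/-- The constant in the rate of convergence. Its terms come from the telescoping objective, the
iterations too early for the lag, the drift of the parameters and the mixing error. -/
noncomputable def rateConst (n : ℕ) (Uf UΘ Uπ G L L₀ κ₀ UJ η₁ r : ℝ) : ℝ :=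
  (min 1 Uf)⁻¹ * (2 * UJ * η₁⁻¹ + 2 * (min 1 Uf * G ^ 2) +
    10 * driftConst n Uf UΘ Uπ G L L₀ * (η₁ * (1 - r)⁻¹) + 2 * G ^ 2 * κ₀)

theorem avgSqGrad_nonneg {d : ℕ} {S A Ω : Type*} [MeasurableSpace Ω] (J : Param d → ℝ)
    (μ : Measure Ω) (X : Run d S A Ω) (K : ℕ) : 0 ≤ avgSqGrad J μ X K :=
  mul_nonneg (by positivity) (Finset.sum_nonneg fun _ _ => integral_nonneg fun _ => by positivity)

end Rate

section Average

variable {d : ℕ} {S A Ω : Type*} [MeasurableSpace S] [MeasurableSpace A] [mΩ : MeasurableSpace Ω]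
  {M : MDP d S A} {γ : ℝ} {n : ℕ} {R : EstimatorKind} {Uf c η₁ r : ℝ} {B : ℕ → ℕ} {F₀ : Finset ℤ}
  {μ : Measure Ω} {ℱ : Filtration ℕ mΩ} {X : Run d S A Ω}
  {Ur UΘ LΘ Uπ κ₀ κ G L L₀ UJ : ℝ} {dstat : Param d → Measure S} {J : Param d → ℝ}

/-- The lag `m = ⌈t*_K⌉` balances the mixing error `κ^(n m) ≤ K^(-r)` against the drift of the
parameters over `B K + m` iterations. -/
theorem IsPGVRER.avgSqGrad_le [IsProbabilityMeasure μ] (hX : IsPGVRER M γ n R Uf c η₁ r B F₀ μ ℱ X)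
    (hn : 1 ≤ n) (hreg : M.Regular Ur UΘ LΘ Uπ) (herg : M.UniformlyErgodic dstat κ₀ κ)
    (hJ : M.SmoothObjective γ dstat J G L L₀) (hUJ : ∀ θ, |J θ| ≤ UJ) (hc : 1 ≤ c) (hη : 0 < η₁)
    (hr₀ : 0 < r) (hr₁ : r < 1) (hUf : 0 < Uf) (hUΘ : 0 ≤ UΘ) (hUπ : 0 ≤ Uπ) (hκ₀ : 0 ≤ κ₀)
    (hκ : 0 < κ) (hκ₁ : κ < 1) (hmono : Monotone B) (hB : ∀ k, 1 ≤ B k)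
    (hratio : BoundedRatio M R Uf) {K : ℕ} (hK : 1 ≤ K) :
    avgSqGrad J μ X K ≤ rateConst n Uf UΘ Uπ G L L₀ κ₀ UJ η₁ r *
      (1 / (K : ℝ) ^ (1 - r) + mixingLag κ r n K ^ 2 / (K : ℝ) ^ r +
        (B K + mixingLag κ r n K) / (K : ℝ) ^ r) := by
  have hG := hJ.bound_nonneg
  have hL := hJ.lipschitz_nonneg
  have hL₀ := hJ.scenario_lipschitz_nonneg
  have ht := mixingLag_nonneg hκ hκ₁ hr₀.le n hK
  have hBK : (1 : ℝ) ≤ B K := by exact_mod_cast hB K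
  have hw : 0 < min 1 Uf := lt_min one_pos hUf
  set t := mixingLag κ r n K
  set m := ⌈t⌉₊
  have hm : (m : ℝ) ≤ t + 1 := (Nat.ceil_lt_add_one ht).le
  have hdrift₀ := driftError_nonneg (n := n) (N := B K + m) (m := m) hUf.le hUΘ hUπ hG hL hL₀
  have hdrift : driftError n Uf UΘ Uπ G L L₀ (B K + m) m + L * (Uf * G) ^ 2 ≤
      10 * driftConst n Uf UΘ Uπ G L L₀ * (t ^ 2 + (B K + t)) := by
    refine (driftError_add_le hUf.le hUΘ hUπ hG hL hL₀ ((hB K).trans (by omega)) m).trans ?_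
    rw [mul_comm 10, mul_assoc]
    refine mul_le_mul_of_nonneg_left ?_ (driftConst_nonneg hUf.le hUΘ hUπ hG hL hL₀)
    exact_mod_cast add_sq_add_one_le hBK m.cast_nonneg ht hm
  have hmix : 2 * G ^ 2 * (κ₀ * κ ^ (n * m)) ≤ 2 * G ^ 2 * κ₀ * (K : ℝ) ^ (-r) := by
    rw [← mul_assoc]
    exact mul_le_mul_of_nonneg_left (pow_ceil_mixingLag_le hκ hκ₁ hn hK) (by positivity)
  have haverage := average_le_of_ascent (a := fun k : ℕ => ∫ ω, J (X.θ k ω) ∂μ)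
    (g := fun k : ℕ => min 1 Uf * ∫ ω, ‖gradient J (X.θ k ω)‖ ^ 2 ∂μ) hη hr₀ hr₁
    (fun k => abs_integral_le_of_abs_le fun ω => hUJ _)
    (fun k => mul_le_mul_of_nonneg_left ((le_abs_self _).trans
      (abs_integral_le_of_abs_le fun ω => hJ.sq_norm_gradient_le _)) hw.le)
    (by positivity) (by positivity) (by positivity) hK (by nlinarith)
    (by push_cast; nlinarith) hdrift hmix
    fun k hk hkK => hX.learningRate_mul_integral_sq_norm_gradient_le hn hreg herg hJ hUJ hc hη.le
      hr₀.le hUf hUΘ hUπ hκ₀ hκ.le hκ₁.le hB hratio (Nat.add_le_add_right (hmono hkK) m) hk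
  rw [← Finset.mul_sum, mul_left_comm, ← avgSqGrad] at haverage
  rw [rateConst, mul_assoc, le_inv_mul_iff₀ hw, add_assoc (1 / _), ← add_div]
  exact haverage

end Average

end VRER

theorem corollary2_general
    (n : ℕ) (hn : 1 ≤ n)
    (γ : ℝ) (hγ₀ : 0 ≤ γ) (hγ₁ : γ < 1)
    (Ur UΘ LΘ Uπ : ℝ) (hUr : 0 < Ur) (hUΘ : 0 < UΘ) (hLΘ : 0 < LΘ) (hUπ : 0 < Uπ)
    (κ₀ κ : ℝ) (hκ₀ : 0 < κ₀) (hκ_pos : 0 < κ) (hκ_lt : κ < 1)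
    (UJ : ℝ) (Uf : ℝ) (hUf : 0 < Uf) (c : ℝ) (hc : 1 ≤ c)
    (r : ℝ) (hr₀ : 0 < r) (hr₁ : r < 1) :
    (∃ L : ℝ, 0 < L ∧
      ∀ (d : ℕ) (S : Type u) (A : Type v) [MeasurableSpace S] [MeasurableSpace A]
        (M : VRER.MDP d S A) (dstat : VRER.Param d → Measure S) (J : VRER.Param d → ℝ),
        M.Regular Ur UΘ LΘ Uπ → M.UniformlyErgodic dstat κ₀ κ → M.IsObjective γ dstat UJ J →
        ∀ θ₁ θ₂, ‖gradient J θ₁ - gradient J θ₂‖ ≤ L * ‖θ₁ - θ₂‖) ∧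
    ∀ η₁ : ℝ, 0 < η₁ →
      ∃ C : ℝ, 0 < C ∧
        ∀ (d : ℕ) (S : Type u) (A : Type v) (Ω : Type w) [MeasurableSpace S] [MeasurableSpace A]
          [mΩ : MeasurableSpace Ω]
          (M : VRER.MDP d S A) (dstat : VRER.Param d → Measure S) (J : VRER.Param d → ℝ),
          M.Regular Ur UΘ LΘ Uπ → M.UniformlyErgodic dstat κ₀ κ → M.IsObjective γ dstat UJ J →
          ∀ R : VRER.EstimatorKind, VRER.BoundedRatio M R Uf →
          ∀ B : ℕ → ℕ, Monotone B → (∀ k, 1 ≤ B k) →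
          ∀ (F₀ : Finset ℤ) (μ : Measure Ω) [IsProbabilityMeasure μ] (ℱ : Filtration ℕ mΩ)
            (X : VRER.Run d S A Ω),
          VRER.IsPGVRER M γ n R Uf c η₁ r B F₀ μ ℱ X →
            (∀ K : ℕ, 1 ≤ K →
              VRER.avgSqGrad J μ X K ≤
                C * (1 / (K : ℝ) ^ (1 - r) + VRER.mixingLag κ r n K ^ 2 / (K : ℝ) ^ r +
                  (B K + VRER.mixingLag κ r n K) / (K : ℝ) ^ r)) ∧
            (Tendsto (fun K : ℕ => (B K : ℝ) / (K : ℝ) ^ r) atTop (𝓝 0) →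
              Tendsto (fun K : ℕ => VRER.avgSqGrad J μ X K) atTop (𝓝 0)) := by
  have hL₀ := (VRER.MDP.gradLip_pos hγ₁ hUr hUΘ hLΘ hUπ).le
  have hL := VRER.MDP.policyGradLip_pos hγ₁ hUr hUΘ hLΘ hUπ hκ₀.le hκ_pos.le hκ_lt
  refine ⟨⟨_, hL, fun d S A _ _ M dstat J hreg herg hobj =>
    (hobj.smoothObjective hreg herg hγ₀ hγ₁ hκ_pos.le hκ_lt hL.le hL₀).gradient_lipschitz⟩, ?_⟩
  intro η₁ hη
  set C := VRER.rateConst n Uf UΘ Uπ (VRER.MDP.gradBound γ Ur UΘ)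
    (VRER.MDP.policyGradLip γ Ur UΘ LΘ Uπ κ₀ κ) (VRER.MDP.gradLip γ Ur UΘ LΘ Uπ) κ₀ UJ η₁ r
  refine ⟨max 1 C, lt_max_of_lt_left one_pos, ?_⟩
  intro d S A Ω _ _ mΩ M dstat J hreg herg hobj R hratio B hmono hB F₀ μ _ ℱ X hX
  have hJ := hobj.smoothObjective hreg herg hγ₀ hγ₁ hκ_pos.le hκ_lt hL.le hL₀
  have hrate (K : ℕ) (hK : 1 ≤ K) : VRER.avgSqGrad J μ X K ≤ max 1 C *
      (1 / (K : ℝ) ^ (1 - r) + VRER.mixingLag κ r n K ^ 2 / (K : ℝ) ^ r +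
        (B K + VRER.mixingLag κ r n K) / (K : ℝ) ^ r) := by
    have ht := VRER.mixingLag_nonneg hκ_pos hκ_lt hr₀.le n hK
    exact (hX.avgSqGrad_le hn hreg herg hJ hobj.abs_le hc hη hr₀ hr₁ hUf hUΘ.le hUπ.le hκ₀.le
      hκ_pos hκ_lt hmono hB hratio hK).trans
        (mul_le_mul_of_nonneg_right (le_max_right _ _) (by positivity))
  exact ⟨hrate, fun hBK => squeeze_zero' (.of_forall fun K => VRER.avgSqGrad_nonneg J μ X K)
    ((eventually_ge_atTop 1).mono hrate) (VRER.tendsto_rate hr₀ hr₁ κ (max 1 C) n hBK)⟩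

theorem corollary2
    (n : ℕ) (hn : 1 ≤ n)
    (γ : ℝ) (hγ₀ : 0 ≤ γ) (hγ₁ : γ < 1)
    (Ur UΘ LΘ Uπ : ℝ) (hUr : 0 < Ur) (hUΘ : 0 < UΘ) (hLΘ : 0 < LΘ) (hUπ : 0 < Uπ)
    (κ₀ κ : ℝ) (hκ₀ : 0 < κ₀) (hκ_pos : 0 < κ) (hκ_lt : κ < 1)
    (UJ : ℝ) (Uf : ℝ) (hUf : 0 < Uf) (c : ℝ) (hc : 1 < c)
    (r : ℝ) (hr₀ : 0 < r) (hr₁ : r < 1) :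
    -- the policy gradient is Lipschitz continuous, with a constant `L` that depends only on the
    -- constants above, so that the range of learning rates below is never empty
    (∃ L : ℝ, 0 < L ∧
      ∀ (d : ℕ) (S : Type u) (A : Type v) [MeasurableSpace S] [MeasurableSpace A]
        (M : VRER.MDP d S A) (dstat : VRER.Param d → Measure S) (J : VRER.Param d → ℝ),
        M.Regular Ur UΘ LΘ Uπ → M.UniformlyErgodic dstat κ₀ κ → M.IsObjective γ dstat UJ J →
        ∀ θ₁ θ₂, ‖gradient J θ₁ - gradient J θ₂‖ ≤ L * ‖θ₁ - θ₂‖) ∧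
    -- the rate of convergence, for each Lipschitz constant `L` and each `η₁ ∈ (0, 1/(4L)]`
    ∀ L η₁ : ℝ, 0 < L → 0 < η₁ → η₁ ≤ 1 / (4 * L) →
      ∃ C : ℝ, 0 < C ∧
        ∀ (d : ℕ) (S : Type u) (A : Type v) (Ω : Type w) [MeasurableSpace S] [MeasurableSpace A]
          [mΩ : MeasurableSpace Ω]
          (M : VRER.MDP d S A) (dstat : VRER.Param d → Measure S) (J : VRER.Param d → ℝ),
          M.Regular Ur UΘ LΘ Uπ → M.UniformlyErgodic dstat κ₀ κ → M.IsObjective γ dstat UJ J →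
          (∀ θ₁ θ₂, ‖gradient J θ₁ - gradient J θ₂‖ ≤ L * ‖θ₁ - θ₂‖) →
          ∀ R : VRER.EstimatorKind,
          -- bounded likelihood ratio; the clipped estimator needs no such bound
          (R = VRER.EstimatorKind.LR → ∀ θ₁ θ₂ s a, M.dens θ₁ s a / M.dens θ₂ s a ≤ Uf) →
          ∀ B : ℕ → ℕ, Monotone B → (∀ k, 1 ≤ B k) →
          ∀ (F₀ : Finset ℤ) (μ : Measure Ω) [IsProbabilityMeasure μ] (ℱ : Filtration ℕ mΩ)
            (X : VRER.Run d S A Ω),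
          VRER.IsPGVRER M γ n R Uf c η₁ r B F₀ μ ℱ X →
            (∀ K : ℕ, 1 ≤ K →
              VRER.avgSqGrad J μ X K ≤
                C * (1 / (K : ℝ) ^ (1 - r) + VRER.mixingLag κ r n K ^ 2 / (K : ℝ) ^ r +
                  (B K + VRER.mixingLag κ r n K) / (K : ℝ) ^ r)) ∧
            (Tendsto (fun K : ℕ => (B K : ℝ) / (K : ℝ) ^ r) atTop (𝓝 0) →
              Tendsto (fun K : ℕ => VRER.avgSqGrad J μ X K) atTop (𝓝 0)) := by
  have h := corollary2_general n hn γ hγ₀ hγ₁ Ur UΘ LΘ Uπ hUr hUΘ hLΘ hUπ κ₀ κ hκ₀ hκ_pos hκ_lt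
    UJ Uf hUf c hc.le r hr₀ hr₁
  exact ⟨h.1, fun _ η₁ _ hη _ => (h.2 η₁ hη).imp fun _ hC =>
    ⟨hC.1, fun d S A Ω _ _ _ M dstat J hreg herg hobj _ =>
      hC.2 d S A Ω M dstat J hreg herg hobj⟩⟩
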